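/- Let $K$ be a field, $n\ge 1$, and let $\mathbf a=(a_1,\dots,a_n)$ be a sequence of nonnegative integers with $a_n>0$ and $a_n>a_i$ for all $i<n$. Let $S=K[x_1,\dots,x_n]$ and let $I(\mathbf a)$ be the kernel of the $K$-algebra map $S\to K[t]$, $x_i\mapsto t^{a_i}$. Let $I(\mathbf a)^h\subset S[x_0]$ be its homogenization with respect to $x_0$. The projective monomial curve $\overline{C(\mathbf a)}$ is called arithmetically Cohen–Macaulay (ACM) if $S[x_0]/I(\mathbf a)^h$ is a Cohen–Macaulay ring. Let $\mathbf a'=(a_n-a_1,\dots,a_n-a_{n-1},a_n)$ be the dual sequence. Fix a (graded) reverse lexicographic monomial order on $S$, for any ordering of the variables in which $x_n$ is the smallest, write $\mathrm{in}(f)$ for the initial monomial of $f$, and let $\mathcal G$ and $\mathcal G'$ be the reduced Gröbner bases of $I(\mathbf a)$ and $I(\mathbf a')$ with respect to this order. For $w\in\mathbb Z^n$ write $w=w^+-w^-$ with $w^+,w^-$ nonnegative of disjoint supports, and put $f_w=x^{w^+}-x^{w^-}$ and $\sigma(w)=(w_1,\dots,w_{n-1},-\sum_{i=1}^n w_i)$.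 The following conditions are equivalent: (a) $\overline{C(\mathbf a)}$ is ACM; (b) $\mathrm{in}(f_{\sigma(w)})=\mathrm{in}(f_w)$ for all $w\in\mathbb Z^n$ with $f_w\in\mathcal G$; (c) for all $w\in\mathbb Z^n$: ($f_w\in\mathcal G$ and $\mathrm{in}(f_w)=x^{w^+}$) if and only if ($f_{\sigma(w)}\in\mathcal G'$ and $\mathrm{in}(f_{\sigma(w)})=x^{\sigma(w)^+}$). Moreover, if $\operatorname{char} K\ne 2$, they are also equivalent to the following condition: for all $w\in\mathbb Z^n$, $f_w\in\mathcal G$ if and only if $f_{\sigma(w)}\in\mathcal G'$. -/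

import Mathlib

namespace MonomialCurve

open MvPolynomial

noncomputable section

/-! ### Graded reverse lexicographic orders -/

/-- The exponent vectors of monomials in variables indexed by `ι`. This synonym carries the graded
reverse lexicographic order in which the variables, from largest to smallest, are
`e.symm 0, e.symm 1, …, e.symm (N - 1)`. -/
def RevLexSyn {ι : Type*} {N : ℕ} (_e : ι ≃ Fin N) : Type _ := ι →₀ ℕ

instance {ι : Type*} {N : ℕ} (e : ι ≃ Fin N) : AddCommMonoid (RevLexSyn e) :=
  inferInstanceAs (AddCommMonoid (ι →₀ ℕ))

/-- The identity map to the synonym. -/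
def toRevLex {ι : Type*} {N : ℕ} (e : ι ≃ Fin N) : (ι →₀ ℕ) ≃+ RevLexSyn e :=
  AddEquiv.refl (ι →₀ ℕ)

/-- Compare first total degrees, then the exponents, starting from the last variable, with the
order reversed. -/
def revLexKey {ι : Type*} {N : ℕ} (e : ι ≃ Fin N) (α : ι →₀ ℕ) :
    ℕ ×ₗ (Colex (Fin N → ℕ))ᵒᵈ :=
  toLex (α.degree, OrderDual.toDual (toColex fun k => α (e.symm k)))

theorem revLexKey_injective {ι : Type*} {N : ℕ} (e : ι ≃ Fin N) :
    Function.Injective (revLexKey e) := by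
  intro α β h
  have h2 := congrArg (fun p => ofColex (OrderDual.ofDual (ofLex p).2)) h
  ext i
  simpa [revLexKey] using congrFun h2 (e i)

instance {ι : Type*} {N : ℕ} (e : ι ≃ Fin N) : LinearOrder (RevLexSyn e) :=
  LinearOrder.lift' (fun α => revLexKey e ((toRevLex e).symm α))
    ((revLexKey_injective e).comp (toRevLex e).symm.injective)

theorem toRevLex_lt_iff {ι : Type*} {N : ℕ} (e : ι ≃ Fin N) (α β : ι →₀ ℕ) :
    toRevLex e α < toRevLex e β ↔
      α.degree < β.degree ∨
        (α.degree = β.degree ∧ ∃ i, β i < α i ∧ ∀ j, e i < e j → α j = β j) := by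
  change revLexKey e α < revLexKey e β ↔ _
  rw [revLexKey, revLexKey, Prod.Lex.toLex_lt_toLex]
  refine or_congr Iff.rfl (and_congr Iff.rfl ?_)
  rw [OrderDual.toDual_lt_toDual]
  constructor
  · rintro ⟨k, hk, hlt⟩
    refine ⟨e.symm k, hlt, fun j hj => ?_⟩
    have := hk (e j) (by simpa using hj)
    simpa using this.symm
  · rintro ⟨i, hlt, hi⟩
    refine ⟨e i, fun k hk => ?_, by simpa using hlt⟩
    have := hi (e.symm k) (by simpa using hk)
    simpa using this.symm

theorem toRevLex_monotone {ι : Type*} {N : ℕ} (e : ι ≃ Fin N) : Monotone (toRevLex e) := by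
  intro α β h
  rcases eq_or_ne α β with rfl | hne
  · exact le_rfl
  refine le_of_lt ((toRevLex_lt_iff e α β).2 (Or.inl ?_))
  obtain ⟨γ, rfl⟩ := exists_add_of_le h
  rw [map_add]
  have : γ.degree ≠ 0 := fun h0 => hne (by rw [(Finsupp.degree_eq_zero_iff γ).1 h0, add_zero])
  omega

instance {ι : Type*} {N : ℕ} (e : ι ≃ Fin N) : IsOrderedAddMonoid (RevLexSyn e) where
  add_le_add_left := by
    intro x y h z
    obtain ⟨α, rfl⟩ := (toRevLex e).surjective x
    obtain ⟨β, rfl⟩ := (toRevLex e).surjective y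
    obtain ⟨γ, rfl⟩ := (toRevLex e).surjective z
    rcases h.eq_or_lt with h | h
    · rw [h]
    rw [← map_add, ← map_add]
    refine le_of_lt ((toRevLex_lt_iff e _ _).2 ?_)
    have h' := (toRevLex_lt_iff e α β).1 h
    simpa only [map_add, Finsupp.add_apply, add_lt_add_iff_right, add_left_inj] using h'

instance {ι : Type*} {N : ℕ} (e : ι ≃ Fin N) : WellFoundedLT (RevLexSyn e) := by
  have : Finite ι := Finite.of_equiv _ e.symm
  have : WellQuasiOrderedLE (RevLexSyn e) :=
    Monotone.wellQuasiOrderedLE_of_wellQuasiOrderedLE_of_surjective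
      (toRevLex_monotone e) (toRevLex e).surjective
  infer_instance

/-- The (graded) reverse lexicographic monomial order with
`e.symm 0 > e.symm 1 > … > e.symm (N - 1)`; see `revLex_lt_iff`. -/
def revLex {ι : Type*} {N : ℕ} (e : ι ≃ Fin N) : MonomialOrder ι where
  syn := RevLexSyn e
  toSyn := toRevLex e
  toSyn_monotone := toRevLex_monotone e

/-- `x^α < x^β` iff `deg x^α < deg x^β`, or the degrees agree and, for the smallest variable `x_i`
whose exponents in `α` and `β` differ, `α i > β i`. -/
theorem revLex_lt_iff {ι : Type*} {N : ℕ} (e : ι ≃ Fin N) (α β : ι →₀ ℕ) :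
    (revLex e).toSyn α < (revLex e).toSyn β ↔
      α.degree < β.degree ∨
        (α.degree = β.degree ∧ ∃ i, β i < α i ∧ ∀ j, e i < e j → α j = β j) :=
  toRevLex_lt_iff e α β

/-! ### Initial ideals and reduced Gröbner bases -/

/-- The initial monomial `in(f)` of a nonzero polynomial `f`. -/
def initialMonomial {ι K : Type*} [Field K] (m : MonomialOrder ι) (f : MvPolynomial ι K) :
    MvPolynomial ι K :=
  monomial (m.degree f) 1

/-- The initial ideal of an ideal `I`. -/
def initialIdeal {ι K : Type*} [Field K] (m : MonomialOrder ι) (I : Ideal (MvPolynomial ι K)) :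
    Ideal (MvPolynomial ι K) :=
  Ideal.span (initialMonomial m '' {f | f ∈ I ∧ f ≠ 0})

/-- `G` is the reduced Gröbner basis of the ideal `I` with respect to the monomial order `m`. -/
structure IsReducedGroebnerBasis {ι K : Type*} [Field K] (m : MonomialOrder ι)
    (I : Ideal (MvPolynomial ι K)) (G : Set (MvPolynomial ι K)) : Prop where
  finite : G.Finite
  subset : G ⊆ (I : Set (MvPolynomial ι K))
  span_eq : Ideal.span (initialMonomial m '' G) = initialIdeal m I
  monic : ∀ g ∈ G, m.leadingCoeff g = 1
  reduced : ∀ g ∈ G, ∀ h ∈ G, g ≠ h → ∀ α ∈ h.support, ¬ m.degree g ≤ α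

/-! ### Cohen–Macaulay rings -/

/-- A Noetherian local ring is Cohen–Macaulay if its maximal ideal contains a regular sequence
whose length is the Krull dimension. -/
def IsCohenMacaulayLocal (R : Type*) [CommRing R] [IsLocalRing R] : Prop :=
  IsNoetherianRing R ∧
    ∃ rs : List R, (∀ r ∈ rs, r ∈ IsLocalRing.maximalIdeal R) ∧
      RingTheory.Sequence.IsRegular R rs ∧ (rs.length : WithBot ℕ∞) = ringKrullDim R

/-- A Noetherian ring is Cohen–Macaulay if its localizations at all maximal ideals are. -/
def IsCohenMacaulay (R : Type*) [CommRing R] : Prop :=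
  IsNoetherianRing R ∧
    ∀ (P : Ideal R) [P.IsMaximal], IsCohenMacaulayLocal (Localization.AtPrime P)

/-! ### Homogenization -/

/-- The homogenization of a polynomial with respect to a new variable `x_0 = X none`. -/
def homogenize {ι K : Type*} [Field K] (f : MvPolynomial ι K) : MvPolynomial (Option ι) K :=
  ∑ α ∈ f.support,
    rename some (monomial α (coeff α f)) * X none ^ (f.totalDegree - α.degree)

/-- The homogenization `I^h` of an ideal: the ideal generated by the `f^h` with `f ∈ I`. -/
def homogenizeIdeal {ι K : Type*} [Field K] (I : Ideal (MvPolynomial ι K)) :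
    Ideal (MvPolynomial (Option ι) K) :=
  Ideal.span (homogenize '' (I : Set (MvPolynomial ι K)))

/-! ### Monomial curves and dual sequences -/

/-- `I(a)`: the kernel of the `K`-algebra map `K[x_1, …, x_n] → K[t]`, `x_i ↦ t ^ a_i`. -/
def toricIdeal (K : Type*) [Field K] {ι : Type*} (a : ι → ℕ) : Ideal (MvPolynomial ι K) :=
  RingHom.ker (aeval (fun i => (Polynomial.X : Polynomial K) ^ a i) :
    MvPolynomial ι K →ₐ[K] Polynomial K)

/-- The projective monomial curve of `a` over `K` is arithmetically Cohen–Macaulay: its homogeneous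
coordinate ring `K[x_0, …, x_n] / I(a)^h` is Cohen–Macaulay. -/
def IsACM (K : Type*) [Field K] {ι : Type*} (a : ι → ℕ) : Prop :=
  IsCohenMacaulay (MvPolynomial (Option ι) K ⧸ homogenizeIdeal (toricIdeal K a))

/-- The dual sequence `a_n - a_1, …, a_n - a_{n-1}, a_n`. It is used only if all entries of `a` are
at most the last one. -/
def dualSeq {n : ℕ} (a : Fin (n + 1) → ℕ) : Fin (n + 1) → ℕ :=
  fun i => if i = Fin.last n then a (Fin.last n) else a (Fin.last n) - a i

/-- `w⁺` as an exponent vector. -/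
def posPart {n : ℕ} (w : Fin n → ℤ) : Fin n →₀ ℕ :=
  Finsupp.equivFunOnFinite.symm fun i => (w i).toNat

/-- `w⁻` as an exponent vector. -/
def negPart {n : ℕ} (w : Fin n → ℤ) : Fin n →₀ ℕ :=
  Finsupp.equivFunOnFinite.symm fun i => (-w i).toNat

/-- The binomial `f_w = x^{w⁺} - x^{w⁻}`. -/
def binomial (K : Type*) [Field K] {n : ℕ} (w : Fin n → ℤ) : MvPolynomial (Fin n) K :=
  monomial (posPart w) 1 - monomial (negPart w) 1

/-- `σ(w_1, …, w_n) = (w_1, …, w_{n-1}, -∑ w_i)`. -/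
def sigma {n : ℕ} (w : Fin (n + 1) → ℤ) : Fin (n + 1) → ℤ :=
  fun i => if i = Fin.last n then -∑ j, w j else w i

end

end MonomialCurve

/-!
# Arithmetically Cohen–Macaulay monomial curves and dual Gröbner bases

Write `d` for the last entry `a_n`. Two monomials are congruent modulo `I(a)` iff they have the same
`a`-weight, so the monomials outside the initial ideal, the standard ones, are the smallest in their
fibres, and the elements of the reduced Gröbner basis are the differences `x^α - x^β` of a minimal
non-standard monomial and its standard representative
(`IsReducedGroebnerBasis.binomial_mem_iff`). All conditions of the theorem are compared with one
condition on monomials, `LastFree`: multiplication by `x_n` preserves standard monomials, or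
equivalently no minimal generator of the initial ideal is divisible by `x_n`.

*Gröbner bases.* As the order is graded and `x_n` is the smallest variable, a minimal generator
`x^{w⁺}` divisible by `x_n` has `deg x^{w⁺} > deg x^{w⁻}`, and then `f_{σ(w)}` has the other initial
monomial (`toSyn_posPart_sigma_lt`); this contradicts the conditions on initial monomials. For the
converse, monomials prime to `x_n` are standard for `a` iff they are standard for the dual sequence
`a'`, with no hypothesis (`isStandard_dualSeq_iff`). Under `LastFree`, which passes to `a'`
(`LastFree.dualSeq`), this extends to all monomials, so both initial ideals agree and `σ`
matches the two reduced Gröbner bases (`LastFree.isReducedBinomial_sigma_iff`).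

*The coordinate ring.* The ring `R = S[x_0] / I(a)^h` embeds into `K[s][t]` by `x_0 ↦ s`,
`x_i ↦ s t^{a_i}` (`coordMap_injective`), and is integral over `K[x_0, x_n]`. Under `LastFree` the
monomials `x_0^j x_n^k x^β`, with `x^β` standard and prime to `x_n`, form a `K`-basis of `R`. Hence
`R` is free over `K[x_0, x_n]`, and minimal polynomials of the residues of `x_0` and `x_n` give a
regular sequence of length `2` at each maximal ideal (`isCohenMacaulay_of_basis`). If `LastFree`
fails, there is a standard `x^α` such that `x_n x^α` is divisible by `x_0` in `R`, while `x^α` is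
not. The annihilator of `x^α` in `R / x_0 R` contains `x_0` and `x_n`, so the irrelevant ideal is an
associated prime of `R / x_0 R`. The local ring there has no regular sequence of length `2`, but its
dimension is at least `2` (`not_isCohenMacaulayLocal_of_colon`, `two_le_height_irrelevantIdeal`).
-/

namespace MonomialCurve

open MvPolynomial

noncomputable section

/-! ### Standard monomials of a toric ideal -/

section Toric

variable {ι K : Type*} [Field K]

/-- The exponent `α` is the smallest one, for the monomial order `m`, among the exponents of the
same `a`-weight. These are the exponents of the standard monomials of `I(a)`, that is, of the
monomials outside the initial ideal. -/
def IsStandard (m : MonomialOrder ι) (a : ι → ℕ) (α : ι →₀ ℕ) : Prop :=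
  ∀ β, Finsupp.weight a β = Finsupp.weight a α → m.toSyn α ≤ m.toSyn β

theorem IsStandard.of_le {m : MonomialOrder ι} {a : ι → ℕ} {α β : ι →₀ ℕ}
    (h : IsStandard m a α) (hle : β ≤ α) : IsStandard m a β := by
  intro γ hγ
  obtain ⟨δ, rfl⟩ := exists_add_of_le hle
  have := h (γ + δ) (by simp [hγ])
  simpa using this

theorem IsStandard.eq {m : MonomialOrder ι} {a : ι → ℕ} {α β : ι →₀ ℕ}
    (hα : IsStandard m a α) (hβ : IsStandard m a β)
    (h : Finsupp.weight a α = Finsupp.weight a β) : α = β :=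
  m.toSyn.injective (le_antisymm (hα _ h.symm) (hβ _ h))

theorem exists_isStandard (m : MonomialOrder ι) (a : ι → ℕ) (α : ι →₀ ℕ) :
    ∃ β, Finsupp.weight a β = Finsupp.weight a α ∧ IsStandard m a β := by
  obtain ⟨β, hβ, hmin⟩ := (InvImage.wf m.toSyn (wellFounded_lt)).has_min
    {β | Finsupp.weight a β = Finsupp.weight a α} ⟨α, rfl⟩
  exact ⟨β, hβ, fun γ hγ => not_lt.1 (hmin γ (hγ.trans hβ))⟩

theorem exists_minimal_not_isStandard [Finite ι] {m : MonomialOrder ι} {a : ι → ℕ}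
    {α : ι →₀ ℕ} (h : ¬ IsStandard m a α) :
    ∃ γ ≤ α, Minimal (fun γ => ¬ IsStandard m a γ) γ :=
  exists_minimal_le_of_wellFoundedLT (fun γ => ¬ IsStandard m a γ) α h

/-- A minimal non-standard monomial and the standard monomial congruent to it are coprime: a common
factor could be cancelled. -/
theorem eq_zero_or_eq_zero_of_minimal {m : MonomialOrder ι} {a : ι → ℕ} {α β : ι →₀ ℕ}
    (hα : Minimal (fun γ => ¬ IsStandard m a γ) α) (hβ : IsStandard m a β)
    (h : Finsupp.weight a β = Finsupp.weight a α) (i : ι) : α i = 0 ∨ β i = 0 := by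
  classical
  by_contra! hne
  have h1 : Finsupp.single i 1 ≤ α := by
    rw [Finsupp.single_le_iff]; omega
  have h2 : Finsupp.single i 1 ≤ β := by
    rw [Finsupp.single_le_iff]; omega
  obtain ⟨α', rfl⟩ := exists_add_of_le h1
  obtain ⟨β', rfl⟩ := exists_add_of_le h2
  have hα' : IsStandard m a α' := by
    by_contra hn
    have := hα.2 hn (by simp)
    have := this i
    simp at this
  have hβ' : IsStandard m a β' := hβ.of_le (by simp)
  have : α' = β' := hα'.eq hβ' (by simpa using h.symm)
  subst this
  exact hα.1 hβ

/-! ### The reduced Gröbner basis of a toric ideal -/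

theorem aeval_pow_monomial (a : ι → ℕ) (α : ι →₀ ℕ) (c : K) :
    aeval (fun i => (Polynomial.X : Polynomial K) ^ a i) (monomial α c) =
      Polynomial.monomial (Finsupp.weight a α) c := by
  rw [aeval_monomial, ← Polynomial.C_mul_X_pow_eq_monomial, Finsupp.weight_apply]
  congr 1
  simp only [Finsupp.prod, Finsupp.sum, ← pow_mul, Finset.prod_pow_eq_pow_sum, smul_eq_mul]
  simp only [mul_comm]

theorem monomial_sub_monomial_mem_toricIdeal {a : ι → ℕ} {α β : ι →₀ ℕ} :
    monomial α (1 : K) - monomial β 1 ∈ toricIdeal K a ↔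
      Finsupp.weight a α = Finsupp.weight a β := by
  rw [toricIdeal, RingHom.mem_ker, map_sub, sub_eq_zero]
  change aeval _ (monomial α (1 : K)) = aeval _ (monomial β (1 : K)) ↔ _
  rw [aeval_pow_monomial, aeval_pow_monomial, Polynomial.monomial_left_inj one_ne_zero]

theorem sum_coeff_eq_zero_of_mem_toricIdeal {a : ι → ℕ} {f : MvPolynomial ι K}
    (hf : f ∈ toricIdeal K a) (u : ℕ) :
    ∑ α ∈ f.support with Finsupp.weight a α = u, coeff α f = 0 := by
  have h : aeval (fun i => (Polynomial.X : Polynomial K) ^ a i) f = 0 := hf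
  rw [f.as_sum, map_sum] at h
  have h2 := congrArg (fun p => Polynomial.coeff p u) h
  simp only [aeval_pow_monomial, Polynomial.finsetSum_coeff, Polynomial.coeff_monomial,
    Polynomial.coeff_zero] at h2
  rwa [Finset.sum_filter]

/-- The leading monomial of `f ∈ I(a)` cannot be alone in its fibre, since the coefficients of `f`
over each fibre add up to `0`. -/
theorem not_isStandard_degree (m : MonomialOrder ι) {a : ι → ℕ} {f : MvPolynomial ι K}
    (hf : f ∈ toricIdeal K a) (h0 : f ≠ 0) : ¬ IsStandard m a (m.degree f) := by
  intro hs
  have h := sum_coeff_eq_zero_of_mem_toricIdeal hf (Finsupp.weight a (m.degree f))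
  rw [Finset.sum_eq_single (m.degree f)] at h
  · exact (m.coeff_degree_ne_zero_iff.2 h0) h
  · intro β hβ hne
    rw [Finset.mem_filter] at hβ
    exact absurd (m.toSyn.injective (le_antisymm (m.le_degree hβ.1) (hs β hβ.2))) hne
  · intro hn
    exact (hn (Finset.mem_filter.2 ⟨m.degree_mem_support h0, rfl⟩)).elim

theorem degree_monomial_sub_monomial {m : MonomialOrder ι} {α β : ι →₀ ℕ}
    (h : m.toSyn β < m.toSyn α) : m.degree (monomial α (1 : K) - monomial β 1) = α := by
  classical
  rw [m.degree_sub_of_lt]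
  · simp [m.degree_monomial]
  · simpa [m.degree_monomial] using h

theorem initialIdeal_toricIdeal (m : MonomialOrder ι) (a : ι → ℕ) :
    initialIdeal m (toricIdeal K a) =
      Ideal.span ((fun α => monomial α 1) '' {α | ¬ IsStandard m a α}) := by
  rw [initialIdeal]
  congr 1
  ext p
  constructor
  · rintro ⟨f, ⟨hf, h0⟩, rfl⟩
    exact ⟨_, not_isStandard_degree m hf h0, rfl⟩
  · rintro ⟨α, hα, rfl⟩
    simp only [Set.mem_ofPred_eq, IsStandard, not_forall, not_le] at hα
    obtain ⟨β, hβ, hlt⟩ := hα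
    refine ⟨monomial α 1 - monomial β 1,
      ⟨monomial_sub_monomial_mem_toricIdeal.2 hβ.symm, fun h => ?_⟩, ?_⟩
    · rw [sub_eq_zero] at h
      have := monomial_left_injective (one_ne_zero (α := K)) h
      exact hlt.ne (by rw [this])
    · simp only [initialMonomial, degree_monomial_sub_monomial hlt]

namespace IsReducedGroebnerBasis

variable {m : MonomialOrder ι} {a : ι → ℕ} {G : Set (MvPolynomial ι K)}

theorem ne_zero {I : Ideal (MvPolynomial ι K)} (hG : IsReducedGroebnerBasis m I G)
    {g : MvPolynomial ι K} (hg : g ∈ G) : g ≠ 0 := by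
  rintro rfl
  simpa using hG.monic 0 hg

variable (hG : IsReducedGroebnerBasis m (toricIdeal K a) G)
include hG

theorem exists_degree_le {α : ι →₀ ℕ} (h : ¬ IsStandard m a α) : ∃ g ∈ G, m.degree g ≤ α := by
  have hmem : monomial α (1 : K) ∈ Ideal.span (initialMonomial m '' G) := by
    rw [hG.span_eq, initialIdeal_toricIdeal]
    exact Ideal.subset_span ⟨α, h, rfl⟩
  have himg : initialMonomial m '' G = (fun s => monomial s (1 : K)) '' (m.degree '' G) := by
    rw [Set.image_image]; rfl
  rw [himg, mem_ideal_span_monomial_image] at hmem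
  obtain ⟨_, ⟨g, hg, rfl⟩, hle⟩ := hmem α (by classical simp [coeff_monomial])
  exact ⟨g, hg, hle⟩

theorem not_isStandard {g : MvPolynomial ι K} (hg : g ∈ G) : ¬ IsStandard m a (m.degree g) :=
  not_isStandard_degree m (hG.subset hg) (hG.ne_zero hg)

theorem minimal_degree {g : MvPolynomial ι K} (hg : g ∈ G) :
    Minimal (fun γ => ¬ IsStandard m a γ) (m.degree g) := by
  refine ⟨hG.not_isStandard hg, fun β hβ hle => ?_⟩
  obtain ⟨g', hg', hle'⟩ := hG.exists_degree_le hβ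
  by_cases h : g' = g
  · rwa [h] at hle'
  · exact absurd (hle'.trans hle)
      (hG.reduced g' hg' g hg h _ (m.degree_mem_support (hG.ne_zero hg)))

theorem isStandard_of_mem_support {g : MvPolynomial ι K} (hg : g ∈ G) {γ : ι →₀ ℕ}
    (hγ : γ ∈ g.support) (hne : γ ≠ m.degree g) : IsStandard m a γ := by
  by_contra hn
  obtain ⟨g', hg', hle⟩ := hG.exists_degree_le hn
  by_cases h : g' = g
  · subst h
    exact hne (m.toSyn.injective (le_antisymm (m.le_degree hγ) (m.toSyn_monotone hle)))
  · exact hG.reduced g' hg' g hg h γ hγ hle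

/-- Every element of the reduced Gröbner basis with leading exponent `α` agrees with the binomial
of `α` and its standard representative, since their difference has only standard monomials. -/
theorem monomial_sub_monomial_mem {α β : ι →₀ ℕ}
    (hα : Minimal (fun γ => ¬ IsStandard m a γ) α) (hβ : IsStandard m a β)
    (h : Finsupp.weight a α = Finsupp.weight a β) :
    monomial α (1 : K) - monomial β 1 ∈ G := by
  classical
  obtain ⟨g, hg, hle⟩ := hG.exists_degree_le hα.1
  have hdeg : m.degree g = α := le_antisymm hle (hα.2 (hG.not_isStandard hg) hle)
  have hαβ : α ≠ β := fun h => hα.1 (h ▸ hβ)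
  suffices hz : g - (monomial α 1 - monomial β 1) = 0 by
    rwa [← sub_eq_zero.1 hz]
  by_contra hne
  have hmem : g - (monomial α (1 : K) - monomial β 1) ∈ toricIdeal K a :=
    sub_mem (hG.subset hg) (monomial_sub_monomial_mem_toricIdeal.2 h)
  refine not_isStandard_degree m hmem hne ?_
  have hsupp := m.degree_mem_support hne
  set γ := m.degree (g - (monomial α (1 : K) - monomial β 1))
  by_cases hγα : γ = α
  · rw [hγα, mem_support_iff] at hsupp
    have hc : coeff α g = 1 := by
      rw [← hdeg]; exact hG.monic g hg
    simp [hc, hαβ.symm] at hsupp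
  by_cases hγβ : γ = β
  · rwa [hγβ]
  · refine hG.isStandard_of_mem_support hg (γ := γ) ?_ (by rwa [hdeg])
    rw [mem_support_iff] at hsupp ⊢
    simpa [coeff_monomial, Ne.symm hγα, Ne.symm hγβ] using hsupp

end IsReducedGroebnerBasis

end Toric

/-! ### Exponent vectors of binomials -/

section Binomial

variable {N : ℕ}

theorem posPart_apply (w : Fin N → ℤ) (i : Fin N) : posPart w i = (w i).toNat := rfl

theorem negPart_apply (w : Fin N → ℤ) (i : Fin N) : negPart w i = (-w i).toNat := rfl

theorem posPart_neg (w : Fin N → ℤ) : posPart (-w) = negPart w := rfl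

theorem negPart_neg (w : Fin N → ℤ) : negPart (-w) = posPart w := by
  ext i; simp [posPart_apply, negPart_apply]

theorem posPart_sub_negPart (w : Fin N → ℤ) (i : Fin N) :
    (posPart w i : ℤ) - negPart w i = w i := by
  rw [posPart_apply, negPart_apply]; omega

theorem posPart_eq_negPart_iff {w : Fin N → ℤ} : posPart w = negPart w ↔ w = 0 := by
  constructor
  · intro h
    ext i
    have := posPart_sub_negPart w i
    rw [h] at this
    simpa using this.symm
  · rintro rfl
    ext i; simp [posPart_apply, negPart_apply]

theorem weight_posPart_sub_weight_negPart (a : Fin N → ℕ) (w : Fin N → ℤ) :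
    (Finsupp.weight a (posPart w) : ℤ) - Finsupp.weight a (negPart w) = ∑ i, w i * a i := by
  rw [Finsupp.weight_eq_sum, Finsupp.weight_eq_sum]
  push_cast
  rw [← Finset.sum_sub_distrib]
  refine Finset.sum_congr rfl fun i _ => ?_
  rw [← posPart_sub_negPart w i]
  simp only [smul_eq_mul]
  push_cast
  ring

theorem degree_posPart_sub_degree_negPart (w : Fin N → ℤ) :
    ((posPart w).degree : ℤ) - (negPart w).degree = ∑ i, w i := by
  rw [Finsupp.degree_eq_sum, Finsupp.degree_eq_sum]
  push_cast
  rw [← Finset.sum_sub_distrib]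
  exact Finset.sum_congr rfl fun i _ => posPart_sub_negPart w i

theorem posPart_sub {α β : Fin N →₀ ℕ} (h : ∀ i, α i = 0 ∨ β i = 0) :
    posPart (fun i => (α i : ℤ) - β i) = α := by
  ext i
  rw [posPart_apply]
  have := h i
  omega

theorem negPart_sub {α β : Fin N →₀ ℕ} (h : ∀ i, α i = 0 ∨ β i = 0) :
    negPart (fun i => (α i : ℤ) - β i) = β := by
  ext i
  rw [negPart_apply]
  have := h i
  omega

variable (K : Type*) [Field K]

theorem binomial_neg (w : Fin N → ℤ) : binomial K (-w) = -binomial K w := by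
  rw [binomial, binomial, posPart_neg, negPart_neg, neg_sub]

theorem binomial_eq_zero_iff {w : Fin N → ℤ} : binomial K w = 0 ↔ w = 0 := by
  rw [binomial, sub_eq_zero, ← posPart_eq_negPart_iff]
  exact (monomial_left_injective (one_ne_zero (α := K))).eq_iff

theorem initialMonomial_neg {ι : Type*} (m : MonomialOrder ι) (f : MvPolynomial ι K) :
    initialMonomial m (-f) = initialMonomial m f := by
  rw [initialMonomial, initialMonomial, m.degree_neg]

theorem initialMonomial_eq_iff {ι : Type*} (m : MonomialOrder ι) (f : MvPolynomial ι K)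
    {α : ι →₀ ℕ} : initialMonomial m f = monomial α 1 ↔ m.degree f = α := by
  exact (monomial_left_injective (one_ne_zero (α := K))).eq_iff

theorem degree_binomial_of_lt {m : MonomialOrder (Fin N)} {w : Fin N → ℤ}
    (h : m.toSyn (negPart w) < m.toSyn (posPart w)) : m.degree (binomial K w) = posPart w :=
  degree_monomial_sub_monomial h

theorem degree_binomial_of_gt {m : MonomialOrder (Fin N)} {w : Fin N → ℤ}
    (h : m.toSyn (posPart w) < m.toSyn (negPart w)) : m.degree (binomial K w) = negPart w := by
  rw [← m.degree_neg, ← binomial_neg, ← posPart_neg]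
  exact degree_binomial_of_lt K (by rwa [posPart_neg, negPart_neg])

/-- The binomial `f_w`, with initial monomial `x^{w⁺}`, belongs to the reduced Gröbner basis of
`I(a)`; see `IsReducedGroebnerBasis.binomial_mem_iff`. -/
structure IsReducedBinomial (m : MonomialOrder (Fin N)) (a : Fin N → ℕ) (w : Fin N → ℤ) :
    Prop where
  minimal : Minimal (fun γ => ¬ IsStandard m a γ) (posPart w)
  isStandard : IsStandard m a (negPart w)
  weight_eq : Finsupp.weight a (posPart w) = Finsupp.weight a (negPart w)

variable {K} {m : MonomialOrder (Fin N)} {a : Fin N → ℕ} {G : Set (MvPolynomial (Fin N) K)}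

theorem IsReducedBinomial.lt {w : Fin N → ℤ} (h : IsReducedBinomial m a w) :
    m.toSyn (negPart w) < m.toSyn (posPart w) := by
  refine lt_of_le_of_ne (h.isStandard _ h.weight_eq) fun heq => h.minimal.1 ?_
  rw [← m.toSyn.injective heq]
  exact h.isStandard

variable (K) in
theorem IsReducedBinomial.initialMonomial_eq {w : Fin N → ℤ} (h : IsReducedBinomial m a w) :
    initialMonomial m (binomial K w) = monomial (posPart w) 1 :=
  (initialMonomial_eq_iff K m _).2 (degree_binomial_of_lt K h.lt)

theorem exists_isReducedBinomial {γ : Fin N →₀ ℕ}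
    (hγ : Minimal (fun γ => ¬ IsStandard m a γ) γ) :
    ∃ w, IsReducedBinomial m a w ∧ posPart w = γ := by
  obtain ⟨β, hβ, hstd⟩ := exists_isStandard m a γ
  have hdisj := eq_zero_or_eq_zero_of_minimal hγ hstd hβ
  refine ⟨fun i => (γ i : ℤ) - β i, ⟨?_, ?_, ?_⟩, posPart_sub hdisj⟩
  · rwa [posPart_sub hdisj]
  · rwa [negPart_sub hdisj]
  · rw [posPart_sub hdisj, negPart_sub hdisj, hβ]

theorem IsReducedGroebnerBasis.binomial_mem_iff
    (hG : IsReducedGroebnerBasis m (toricIdeal K a) G) {w : Fin N → ℤ} :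
    (binomial K w ∈ G ∧ initialMonomial m (binomial K w) = monomial (posPart w) 1) ↔
      IsReducedBinomial m a w := by
  constructor
  · rintro ⟨hw, hin⟩
    rw [initialMonomial_eq_iff] at hin
    have hne : posPart w ≠ negPart w := by
      rw [Ne, posPart_eq_negPart_iff, ← binomial_eq_zero_iff K]
      exact hG.ne_zero hw
    refine ⟨hin ▸ hG.minimal_degree hw, hG.isStandard_of_mem_support hw ?_ ?_,
      monomial_sub_monomial_mem_toricIdeal.1 (hG.subset hw)⟩
    · classical
      rw [mem_support_iff, binomial]
      simp [coeff_monomial, hne]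
    · rw [hin]; exact hne.symm
  · exact fun h => ⟨hG.monomial_sub_monomial_mem h.minimal h.isStandard h.weight_eq,
      h.initialMonomial_eq K⟩

theorem leadingCoeff_binomial_of_gt {w : Fin N → ℤ}
    (h : m.toSyn (posPart w) < m.toSyn (negPart w)) : m.leadingCoeff (binomial K w) = -1 := by
  classical
  rw [MonomialOrder.leadingCoeff, degree_binomial_of_gt K h, binomial]
  have hne : posPart w ≠ negPart w := fun h' => h.ne (by rw [h'])
  simp [coeff_monomial, hne]

/-- A binomial of the reduced Gröbner basis either has initial monomial `x^{w⁺}`, or has initial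
monomial `x^{w⁻}` with coefficient `-1`, which is possible only in characteristic `2`. -/
theorem IsReducedGroebnerBasis.isReducedBinomial_or
    (hG : IsReducedGroebnerBasis m (toricIdeal K a) G) {w : Fin N → ℤ}
    (hw : binomial K w ∈ G) :
    IsReducedBinomial m a w ∨ ((2 : K) = 0 ∧ IsReducedBinomial m a (-w)) := by
  have hne : posPart w ≠ negPart w := by
    rw [Ne, posPart_eq_negPart_iff, ← binomial_eq_zero_iff K]
    exact hG.ne_zero hw
  rcases lt_trichotomy (m.toSyn (negPart w)) (m.toSyn (posPart w)) with h | h | h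
  · exact Or.inl (hG.binomial_mem_iff.1
      ⟨hw, (initialMonomial_eq_iff K m _).2 (degree_binomial_of_lt K h)⟩)
  · exact absurd (m.toSyn.injective h).symm hne
  · have h1 : (1 : K) = -1 := by
      rw [← leadingCoeff_binomial_of_gt h]; exact (hG.monic _ hw).symm
    refine Or.inr ⟨by linear_combination h1, hG.binomial_mem_iff.1 ⟨?_, ?_⟩⟩
    · have hneg : binomial K (-w) = binomial K w := by
        rw [binomial_neg, ← neg_one_smul K, ← h1, one_smul]
      rwa [hneg]
    · rw [binomial_neg, initialMonomial_neg, initialMonomial_eq_iff, posPart_neg]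
      exact degree_binomial_of_gt K h

end Binomial

/-! ### Passing to the dual sequence -/

section Dual

variable {n : ℕ}

theorem weight_dualSeq_add {a : Fin (n + 1) → ℕ} (hle : ∀ i, a i ≤ a (Fin.last n))
    (α : Fin (n + 1) →₀ ℕ) :
    Finsupp.weight (dualSeq a) α + Finsupp.weight a α =
      a (Fin.last n) * (α.degree + α (Fin.last n)) := by
  rw [Finsupp.weight_eq_sum, Finsupp.weight_eq_sum, Finsupp.degree_eq_sum,
    ← Finset.sum_add_distrib, Fin.sum_univ_castSucc, Fin.sum_univ_castSucc]
  have h : ∀ i : Fin n, α i.castSucc • dualSeq a i.castSucc + α i.castSucc • a i.castSucc =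
      a (Fin.last n) * α i.castSucc := by
    intro i
    have hi : i.castSucc ≠ Fin.last n := (Fin.castSucc_lt_last i).ne
    rw [dualSeq, if_neg hi, ← smul_add, Nat.sub_add_cancel (hle _), smul_eq_mul, mul_comm]
  rw [Finset.sum_congr rfl fun i _ => h i, ← Finset.mul_sum, dualSeq, if_pos rfl]
  simp only [smul_eq_mul]
  ring

theorem dualSeq_le (a : Fin (n + 1) → ℕ) (i : Fin (n + 1)) :
    dualSeq a i ≤ dualSeq a (Fin.last n) := by
  rw [dualSeq, dualSeq, if_pos rfl]
  split_ifs
  · exact le_rfl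
  · exact Nat.sub_le _ _

theorem dualSeq_dualSeq {a : Fin (n + 1) → ℕ} (hle : ∀ i, a i ≤ a (Fin.last n)) :
    dualSeq (dualSeq a) = a := by
  ext i
  simp only [dualSeq, if_true]
  split_ifs with h
  · rw [h]
  · exact Nat.sub_sub_self (hle i)

theorem sigma_last (w : Fin (n + 1) → ℤ) : sigma w (Fin.last n) = -∑ j, w j := if_pos rfl

theorem sigma_of_ne (w : Fin (n + 1) → ℤ) {i : Fin (n + 1)} (h : i ≠ Fin.last n) :
    sigma w i = w i := if_neg h

theorem sigma_neg (w : Fin (n + 1) → ℤ) : sigma (-w) = -sigma w := by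
  ext i
  simp only [sigma, Pi.neg_apply, Finset.sum_neg_distrib]
  split_ifs <;> rfl

theorem sum_sigma (w : Fin (n + 1) → ℤ) : ∑ i, sigma w i = -w (Fin.last n) := by
  have h : ∀ i : Fin n, sigma w i.castSucc = w i.castSucc := fun i =>
    sigma_of_ne w (Fin.castSucc_lt_last i).ne
  rw [Fin.sum_univ_castSucc, Finset.sum_congr rfl fun i _ => h i, sigma_last,
    Fin.sum_univ_castSucc]
  ring

theorem sigma_sigma (w : Fin (n + 1) → ℤ) : sigma (sigma w) = w := by
  ext i
  by_cases h : i = Fin.last n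
  · rw [h, sigma_last, sum_sigma, neg_neg]
  · rw [sigma_of_ne _ h, sigma_of_ne _ h]

theorem toSyn_lt_of_degree_lt {e : Fin (n + 1) ≃ Fin (n + 1)} {α β : Fin (n + 1) →₀ ℕ}
    (h : α.degree < β.degree) : (revLex e).toSyn α < (revLex e).toSyn β :=
  (revLex_lt_iff e α β).2 (Or.inl h)

theorem degree_le_of_toSyn_le {e : Fin (n + 1) ≃ Fin (n + 1)} {α β : Fin (n + 1) →₀ ℕ}
    (h : (revLex e).toSyn α ≤ (revLex e).toSyn β) : α.degree ≤ β.degree := by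
  by_contra hn
  exact absurd (toSyn_lt_of_degree_lt (not_le.1 hn)) (not_lt.2 h)

variable {e : Fin (n + 1) ≃ Fin (n + 1)} (he : e (Fin.last n) = Fin.last n)
include he

/-- Reverse lexicographic comparison at the smallest variable. -/
theorem toSyn_lt_of_last_lt {α β : Fin (n + 1) →₀ ℕ} (hdeg : α.degree ≤ β.degree)
    (h : β (Fin.last n) < α (Fin.last n)) : (revLex e).toSyn α < (revLex e).toSyn β := by
  rcases hdeg.lt_or_eq with hlt | heq
  · exact toSyn_lt_of_degree_lt hlt
  refine (revLex_lt_iff e α β).2 (Or.inr ⟨heq, Fin.last n, h, fun j hj => ?_⟩)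
  rw [he] at hj
  exact absurd hj (not_lt.2 (Fin.le_last _))

/-- If `x_n ∤ x^γ`, a monomial `x^δ < x^γ` congruent to `x^γ` modulo `I(a)` becomes one congruent
to `x^γ` modulo `I(a')` when its exponent of `x_n` is replaced by `deg x^γ - deg x^δ`. -/
theorem IsStandard.of_dualSeq {a : Fin (n + 1) → ℕ} (hle : ∀ i, a i ≤ a (Fin.last n))
    {γ : Fin (n + 1) →₀ ℕ} (hγ : γ (Fin.last n) = 0)
    (h : IsStandard (revLex e) (dualSeq a) γ) : IsStandard (revLex e) a γ := by
  intro δ hδ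
  by_contra! hlt
  have hdeg := degree_le_of_toSyn_le hlt.le
  set k := γ.degree - δ.degree with hk
  set ε := δ.erase (Fin.last n) with hε
  have hδε : δ = ε + Finsupp.single (Fin.last n) (δ (Fin.last n)) :=
    (Finsupp.erase_add_single _ _).symm
  have hε0 : ε (Fin.last n) = 0 := by simp [hε]
  have hdδ : δ.degree = ε.degree + δ (Fin.last n) := by
    conv_lhs => rw [hδε]
    simp
  have hwδ : Finsupp.weight a δ = Finsupp.weight a ε + a (Fin.last n) * δ (Fin.last n) := by
    conv_lhs => rw [hδε]
    simp [Finsupp.weight_single, mul_comm]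
  have h1 := weight_dualSeq_add hle γ
  have h2 := weight_dualSeq_add hle ε
  have hw : Finsupp.weight (dualSeq a) (ε + Finsupp.single (Fin.last n) k) =
      Finsupp.weight (dualSeq a) γ := by
    have h3 : dualSeq a (Fin.last n) = a (Fin.last n) := if_pos rfl
    rw [map_add, Finsupp.weight_single, h3, smul_eq_mul]
    rw [hγ, add_zero] at h1
    rw [hε0, add_zero] at h2
    have h4 : γ.degree = k + (ε.degree + δ (Fin.last n)) := by omega
    rw [h4] at h1
    nlinarith
  have hle' := h _ hw
  refine absurd hle' (not_le.2 ?_)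
  by_cases hk0 : k = 0
  · by_cases hδ0 : δ (Fin.last n) = 0
    · have : ε + Finsupp.single (Fin.last n) k = δ := by
        rw [hk0]; conv_rhs => rw [hδε, hδ0]
      rwa [this]
    · refine toSyn_lt_of_degree_lt ?_
      rw [hk0]; simp; omega
  · refine toSyn_lt_of_last_lt he ?_ ?_
    · simp; omega
    · simp [hγ, hε0]; omega

theorem isStandard_dualSeq_iff {a : Fin (n + 1) → ℕ} (hle : ∀ i, a i ≤ a (Fin.last n))
    {γ : Fin (n + 1) →₀ ℕ} (hγ : γ (Fin.last n) = 0) :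
    IsStandard (revLex e) (dualSeq a) γ ↔ IsStandard (revLex e) a γ := by
  refine ⟨IsStandard.of_dualSeq he hle hγ, fun h => IsStandard.of_dualSeq he (dualSeq_le a) hγ ?_⟩
  rwa [dualSeq_dualSeq hle]

end Dual

/-! ### Initial ideals without the last variable -/

section LastFree

variable {n : ℕ} {e : Fin (n + 1) ≃ Fin (n + 1)} {a : Fin (n + 1) → ℕ}

/-- Multiplication by the last variable `x_n` preserves standard monomials of `I(a)`. Equivalently,
`x_n` divides no minimal generator of the initial ideal; see `lastFree_iff`. -/
def LastFree (e : Fin (n + 1) ≃ Fin (n + 1)) (a : Fin (n + 1) → ℕ) : Prop :=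
  ∀ α, IsStandard (revLex e) a α →
    IsStandard (revLex e) a (α + Finsupp.single (Fin.last n) 1)

theorem lastFree_iff : LastFree e a ↔
    ∀ γ, Minimal (fun γ => ¬ IsStandard (revLex e) a γ) γ → γ (Fin.last n) = 0 := by
  constructor
  · intro h γ hγ
    by_contra hne
    have hle : Finsupp.single (Fin.last n) 1 ≤ γ := by
      rw [Finsupp.single_le_iff]; omega
    obtain ⟨α, rfl⟩ := exists_add_of_le hle
    rw [add_comm _ α] at hγ
    refine hγ.1 (h α ?_)
    by_contra hn
    have := hγ.2 hn (by simp) (Fin.last n)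
    simp at this
  · intro h α hα
    by_contra hn
    obtain ⟨γ, hle, hγ⟩ := exists_minimal_not_isStandard hn
    refine hγ.1 (hα.of_le fun i => ?_)
    by_cases hi : i = Fin.last n
    · rw [hi, h γ hγ]; exact Nat.zero_le _
    · simpa [Finsupp.single_apply, Ne.symm hi] using hle i

theorem LastFree.add_single (h : LastFree e a) {α : Fin (n + 1) →₀ ℕ}
    (hα : IsStandard (revLex e) a α) (k : ℕ) :
    IsStandard (revLex e) a (α + Finsupp.single (Fin.last n) k) := by
  induction k with
  | zero => simpa using hα
  | succ k ih =>
    rw [Finsupp.single_add, ← add_assoc]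
    exact h _ ih

theorem LastFree.isStandard_erase_iff (h : LastFree e a) {α : Fin (n + 1) →₀ ℕ} :
    IsStandard (revLex e) a (α.erase (Fin.last n)) ↔ IsStandard (revLex e) a α := by
  constructor
  · intro hα
    have := h.add_single hα (α (Fin.last n))
    rwa [Finsupp.erase_add_single] at this
  · intro hα
    refine hα.of_le fun i => ?_
    by_cases hi : i = Fin.last n
    · simp [hi]
    · simp [Finsupp.erase_ne hi]

variable (he : e (Fin.last n) = Fin.last n) (hle : ∀ i, a i ≤ a (Fin.last n))

include he hle in
/-- The condition passes to the dual sequence. If `x^α` is standard for `a'` but `x_n x^α` is not,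
the standard representative `x^δ` of `x_n x^α` is prime to `x_n`, hence also standard for `a`, and
of smaller degree. Its product with the power of `x_n` that makes up the difference of degrees is
then standard for `a`, but congruent modulo `I(a)` to `x^α` with `x_n` set to `1`, which has smaller
degree. -/
theorem LastFree.dualSeq (h : LastFree e a) : LastFree e (dualSeq a) := by
  intro α hα
  obtain ⟨δ, hδ, hstd⟩ := exists_isStandard (revLex e) (MonomialCurve.dualSeq a)
    (α + Finsupp.single (Fin.last n) 1)
  by_contra hn
  by_cases hδ0 : δ (Fin.last n) = 0
  · set γ := α + Finsupp.single (Fin.last n) 1 with hγ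
    have hγL : 0 < γ (Fin.last n) := by simp [hγ]
    have hdeg : δ.degree < γ.degree := by
      by_contra! hd
      exact absurd (hstd γ hδ.symm) (not_le.2 (toSyn_lt_of_last_lt he hd (by rwa [hδ0])))
    have hstd' := h.add_single ((isStandard_dualSeq_iff he hle hδ0).1 hstd)
      (γ.degree - δ.degree)
    have hγe : γ = γ.erase (Fin.last n) + Finsupp.single (Fin.last n) (γ (Fin.last n)) :=
      (Finsupp.erase_add_single _ _).symm
    have hdγ : γ.degree = (γ.erase (Fin.last n)).degree + γ (Fin.last n) := by
      conv_lhs => rw [hγe]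
      simp
    have hwγ : Finsupp.weight a γ =
        Finsupp.weight a (γ.erase (Fin.last n)) + a (Fin.last n) * γ (Fin.last n) := by
      conv_lhs => rw [hγe]
      simp [Finsupp.weight_single, mul_comm]
    have h1 := weight_dualSeq_add hle γ
    have h2 := weight_dualSeq_add hle δ
    rw [hδ0, add_zero] at h2
    have hw : Finsupp.weight a (γ.erase (Fin.last n)) =
        Finsupp.weight a (δ + Finsupp.single (Fin.last n) (γ.degree - δ.degree)) := by
      rw [map_add, Finsupp.weight_single, smul_eq_mul]
      obtain ⟨k, hk⟩ := Nat.exists_eq_add_of_lt hdeg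
      have h3 : γ.degree - δ.degree = k + 1 := by omega
      rw [h3]
      rw [hwγ] at h1
      rw [show γ.degree = δ.degree + (k + 1) by omega] at h1
      nlinarith
    have hcontra := degree_le_of_toSyn_le (hstd' _ hw)
    simp only [map_add, Finsupp.degree_single] at hcontra
    omega
  · have hle1 : Finsupp.single (Fin.last n) 1 ≤ δ := by
      rw [Finsupp.single_le_iff]; omega
    obtain ⟨δ', rfl⟩ := exists_add_of_le hle1
    rw [add_comm _ δ'] at hstd hδ
    have : δ' = α := (hstd.of_le (by simp)).eq hα (by simpa using hδ)
    rw [this] at hstd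
    exact hn hstd

include he hle in
theorem LastFree.isStandard_dualSeq_iff (h : LastFree e a) {α : Fin (n + 1) →₀ ℕ} :
    IsStandard (revLex e) (MonomialCurve.dualSeq a) α ↔ IsStandard (revLex e) a α := by
  rw [← h.isStandard_erase_iff, ← (h.dualSeq he hle).isStandard_erase_iff,
    MonomialCurve.isStandard_dualSeq_iff he hle (by simp)]

include hle in
theorem sum_sigma_mul_dualSeq (w : Fin (n + 1) → ℤ) :
    ∑ i, sigma w i * (MonomialCurve.dualSeq a i : ℤ) = -∑ i, w i * a i := by
  have h : ∀ i : Fin n, sigma w i.castSucc * (MonomialCurve.dualSeq a i.castSucc : ℤ) =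
      w i.castSucc * a (Fin.last n) - w i.castSucc * a i.castSucc := by
    intro i
    have hi : i.castSucc ≠ Fin.last n := (Fin.castSucc_lt_last i).ne
    rw [sigma_of_ne _ hi, MonomialCurve.dualSeq, if_neg hi, Nat.cast_sub (hle _)]
    ring
  rw [Fin.sum_univ_castSucc, Finset.sum_congr rfl fun i _ => h i, Finset.sum_sub_distrib,
    ← Finset.sum_mul, MonomialCurve.dualSeq, if_pos rfl, sigma_last, Fin.sum_univ_castSucc,
    Fin.sum_univ_castSucc]
  ring

theorem IsReducedBinomial.posPart_sigma (h : LastFree e a) {w : Fin (n + 1) → ℤ}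
    (hw : IsReducedBinomial (revLex e) a w) : posPart (sigma w) = posPart w := by
  have hdeg := degree_le_of_toSyn_le hw.lt.le
  have hsum := degree_posPart_sub_degree_negPart w
  have h0 := lastFree_iff.1 h _ hw.minimal
  ext i
  by_cases hi : i = Fin.last n
  · rw [hi, h0, posPart_apply, sigma_last]
    omega
  · rw [posPart_apply, posPart_apply, sigma_of_ne _ hi]

include he hle in
theorem IsReducedBinomial.sigma (h : LastFree e a) {w : Fin (n + 1) → ℤ}
    (hw : IsReducedBinomial (revLex e) a w) :
    IsReducedBinomial (revLex e) (MonomialCurve.dualSeq a) (sigma w) := by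
  have hiff : ∀ γ, ¬ IsStandard (revLex e) (MonomialCurve.dualSeq a) γ ↔
      ¬ IsStandard (revLex e) a γ := fun γ => not_congr (h.isStandard_dualSeq_iff he hle)
  refine ⟨?_, ?_, ?_⟩
  · simp only [hiff]
    rw [hw.posPart_sigma h]
    exact hw.minimal
  · rw [h.isStandard_dualSeq_iff he hle, ← h.isStandard_erase_iff]
    have : (negPart (MonomialCurve.sigma w)).erase (Fin.last n) =
        (negPart w).erase (Fin.last n) := by
      ext i
      by_cases hi : i = Fin.last n
      · simp [hi]
      · rw [Finsupp.erase_ne hi, Finsupp.erase_ne hi, negPart_apply, negPart_apply,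
          sigma_of_ne _ hi]
    rw [this, h.isStandard_erase_iff]
    exact hw.isStandard
  · have h1 := weight_posPart_sub_weight_negPart a w
    have h2 := weight_posPart_sub_weight_negPart (MonomialCurve.dualSeq a)
      (MonomialCurve.sigma w)
    rw [sum_sigma_mul_dualSeq hle, ← h1, hw.weight_eq] at h2
    omega

include he hle in
theorem LastFree.isReducedBinomial_sigma_iff (h : LastFree e a) (w : Fin (n + 1) → ℤ) :
    IsReducedBinomial (revLex e) a w ↔
      IsReducedBinomial (revLex e) (MonomialCurve.dualSeq a) (sigma w) := by
  refine ⟨IsReducedBinomial.sigma he hle h, fun hw => ?_⟩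
  have := IsReducedBinomial.sigma he (dualSeq_le a) (h.dualSeq he hle) hw
  rwa [sigma_sigma, dualSeq_dualSeq hle] at this

/-- If `x_n` divides `x^{w⁺}`, then the degree of `x^{σ(w)⁻}` exceeds that of `x^{σ(w)⁺}`. -/
theorem toSyn_posPart_sigma_lt {w : Fin (n + 1) → ℤ} (hw : posPart w (Fin.last n) ≠ 0) :
    (revLex e).toSyn (posPart (sigma w)) < (revLex e).toSyn (negPart (sigma w)) := by
  refine toSyn_lt_of_degree_lt ?_
  have h1 := degree_posPart_sub_degree_negPart (sigma w)
  rw [sum_sigma] at h1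
  rw [posPart_apply] at hw
  omega

include he hle in
theorem lastFree_iff_isReducedBinomial_sigma : LastFree e a ↔
    ∀ w, IsReducedBinomial (revLex e) a w ↔
      IsReducedBinomial (revLex e) (MonomialCurve.dualSeq a) (sigma w) := by
  refine ⟨fun h => h.isReducedBinomial_sigma_iff he hle, fun h => lastFree_iff.2 fun γ hγ => ?_⟩
  obtain ⟨w, hw, rfl⟩ := exists_isReducedBinomial hγ
  by_contra hne
  exact lt_asymm (toSyn_posPart_sigma_lt hne) ((h w).1 hw).lt

include he hle in
theorem lastFree_iff_initialMonomial_sigma {K : Type*} [Field K] (hpos : 0 < a (Fin.last n))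
    {G : Set (MvPolynomial (Fin (n + 1)) K)}
    (hG : IsReducedGroebnerBasis (revLex e) (toricIdeal K a) G) : LastFree e a ↔
    ∀ w : Fin (n + 1) → ℤ, binomial K w ∈ G →
      initialMonomial (revLex e) (binomial K (sigma w)) =
        initialMonomial (revLex e) (binomial K w) := by
  constructor
  · intro h
    have key : ∀ w, IsReducedBinomial (revLex e) a w →
        initialMonomial (revLex e) (binomial K (sigma w)) =
          initialMonomial (revLex e) (binomial K w) := by
      intro w hw
      rw [hw.initialMonomial_eq K, (hw.sigma he hle h).initialMonomial_eq K, hw.posPart_sigma h]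
    intro w hw
    rcases hG.isReducedBinomial_or hw with hw | ⟨-, hw⟩
    · exact key w hw
    · have := key _ hw
      rwa [sigma_neg, binomial_neg, binomial_neg, initialMonomial_neg,
        initialMonomial_neg] at this
  · refine fun h => lastFree_iff.2 fun γ hγ => ?_
    obtain ⟨w, hw, rfl⟩ := exists_isReducedBinomial hγ
    by_contra hne
    have hin := h w (hG.binomial_mem_iff.2 hw).1
    rw [hw.initialMonomial_eq K, initialMonomial_eq_iff,
      degree_binomial_of_gt K (toSyn_posPart_sigma_lt hne)] at hin
    -- The parts `w⁺` and `σ(w)⁻` agree, so `w` is a nonzero multiple of the last unit vector.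
    have h0 : ∀ i : Fin n, w i.castSucc = 0 := by
      intro i
      have hi := DFunLike.congr_fun hin i.castSucc
      rw [negPart_apply, posPart_apply, sigma_of_ne _ (Fin.castSucc_lt_last i).ne] at hi
      omega
    have hsum := weight_posPart_sub_weight_negPart a w
    rw [hw.weight_eq, sub_self, Fin.sum_univ_castSucc] at hsum
    simp only [h0, zero_mul, Finset.sum_const_zero, zero_add] at hsum
    rw [posPart_apply] at hne
    rcases mul_eq_zero.1 hsum.symm with h1 | h1 <;> omega

end LastFree

/-! ### The homogeneous coordinate ring -/

section CoordRing

variable {ι : Type*} (K : Type*) [Field K] (a : ι → ℕ)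

/-- The `K`-algebra map `x_0 ↦ s`, `x_i ↦ s t ^ a_i`, where `t` is the outer variable of
`K[s][t]` and `s` the inner one. Its kernel is `I(a)^h`; see `coordMap_injective`. -/
def curveMap : MvPolynomial (Option ι) K →ₐ[K] Polynomial (Polynomial K) :=
  aeval fun o => o.elim (Polynomial.C Polynomial.X)
    fun i => Polynomial.C Polynomial.X * Polynomial.X ^ a i

theorem curveMap_X_none : curveMap K a (X none) = Polynomial.C Polynomial.X := by
  simp [curveMap]

theorem curveMap_rename_some_monomial (α : ι →₀ ℕ) (c : K) :
    curveMap K a (rename some (monomial α c)) =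
      Polynomial.monomial (Finsupp.weight a α) (Polynomial.monomial α.degree c) := by
  rw [curveMap, aeval_rename, aeval_monomial]
  simp only [Function.comp_def, Option.elim_some, mul_pow, Finsupp.prod_mul, ← pow_mul]
  rw [← Polynomial.C_mul_X_pow_eq_monomial, ← Polynomial.C_mul_X_pow_eq_monomial,
    Finsupp.weight_apply, Finsupp.degree_apply]
  simp only [Finsupp.prod, Finsupp.sum, Finset.prod_pow_eq_pow_sum, smul_eq_mul, map_mul, map_pow,
    Polynomial.algebraMap_apply, Polynomial.algebraMap_eq]
  rw [mul_assoc]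
  simp only [mul_comm]

/-- The image of the monomial `x_0 ^ j x ^ α`. -/
theorem curveMap_X_none_pow_mul (j : ℕ) (α : ι →₀ ℕ) :
    curveMap K a (X none ^ j * rename some (monomial α 1)) =
      Polynomial.monomial (Finsupp.weight a α) (Polynomial.monomial (j + α.degree) 1) := by
  rw [map_mul, map_pow, curveMap_X_none, curveMap_rename_some_monomial, ← map_pow,
    Polynomial.C_mul_monomial, Polynomial.X_pow_mul_monomial, add_comm]

theorem curveMap_homogenize (f : MvPolynomial ι K) :
    curveMap K a (homogenize f) =
      Polynomial.C (Polynomial.X ^ f.totalDegree) *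
        (aeval (fun i => (Polynomial.X : Polynomial K) ^ a i) f).map Polynomial.C := by
  have h : aeval (fun i => (Polynomial.X : Polynomial K) ^ a i) f =
      ∑ α ∈ f.support, Polynomial.monomial (Finsupp.weight a α) (coeff α f) := by
    conv_lhs => rw [f.as_sum]
    simp only [map_sum, aeval_pow_monomial]
  rw [homogenize, map_sum, h, Polynomial.map_sum, Finset.mul_sum]
  refine Finset.sum_congr rfl fun α hα => ?_
  have hα' : α.degree ≤ f.totalDegree := le_totalDegree hα
  rw [map_mul, map_pow, curveMap_X_none, curveMap_rename_some_monomial, Polynomial.map_monomial,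
    ← map_pow, mul_comm, Polynomial.C_mul_monomial, Polynomial.X_pow_mul_monomial,
    Polynomial.C_mul_monomial, Polynomial.X_pow_mul_C, Polynomial.C_mul_X_pow_eq_monomial,
    Nat.add_sub_cancel' hα']

theorem homogenizeIdeal_le_ker :
    homogenizeIdeal (toricIdeal K a) ≤ RingHom.ker (curveMap K a) := by
  rw [homogenizeIdeal, Ideal.span_le]
  rintro _ ⟨f, hf, rfl⟩
  have hf0 : aeval (fun i => (Polynomial.X : Polynomial K) ^ a i) f = 0 := hf
  rw [SetLike.mem_coe, RingHom.mem_ker, curveMap_homogenize, hf0, Polynomial.map_zero, mul_zero]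

variable {K a} in
theorem homogenize_monomial_sub_monomial {α β : ι →₀ ℕ} (hne : α ≠ β)
    (hdeg : β.degree ≤ α.degree) :
    homogenize (monomial α (1 : K) - monomial β 1) =
      rename some (monomial α 1) - rename some (monomial β 1) *
        X none ^ (α.degree - β.degree) := by
  classical
  have hsupp : (monomial α (1 : K) - monomial β 1).support = {α, β} := by
    ext γ
    rw [mem_support_iff, coeff_sub, coeff_monomial, coeff_monomial, Finset.mem_insert,
      Finset.mem_singleton]
    by_cases h1 : α = γ
    · subst h1; simp [hne.symm]
    · by_cases h2 : β = γ
      · subst h2; simp [h1]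
      · simp [h1, h2, Ne.symm h1, Ne.symm h2]
  have htot : (monomial α (1 : K) - monomial β 1).totalDegree = α.degree := by
    rw [totalDegree, hsupp, Finset.sup_insert, Finset.sup_singleton]
    exact max_eq_left hdeg
  rw [homogenize, hsupp, htot, Finset.sum_pair hne]
  simp [coeff_monomial, hne, hne.symm, sub_eq_add_neg]

variable {K a} in
theorem X_none_pow_mul_sub_mem_homogenizeIdeal {j k : ℕ} {α β : ι →₀ ℕ}
    (hw : Finsupp.weight a α = Finsupp.weight a β) (hdeg : j + α.degree = k + β.degree) :
    (X none ^ j * rename some (monomial α 1) - X none ^ k * rename some (monomial β 1) :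
      MvPolynomial (Option ι) K) ∈ homogenizeIdeal (toricIdeal K a) := by
  wlog hle : β.degree ≤ α.degree generalizing j k α β
  · rw [← neg_sub]
    exact neg_mem (this hw.symm hdeg.symm (le_of_not_ge hle))
  by_cases hne : α = β
  · subst hne
    have : j = k := by omega
    rw [this, sub_self]
    exact zero_mem _
  have hk : k = j + (α.degree - β.degree) := by omega
  have hmem : homogenize (monomial α (1 : K) - monomial β 1) ∈
      homogenizeIdeal (toricIdeal K a) :=
    Ideal.subset_span ⟨_, monomial_sub_monomial_mem_toricIdeal.2 hw, rfl⟩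
  rw [homogenize_monomial_sub_monomial hne hle] at hmem
  have := Ideal.mul_mem_left _ (X none ^ j) hmem
  convert this using 1
  rw [hk, pow_add]
  ring

/-- The homogeneous coordinate ring `S[x_0] / I(a)^h` of the projective monomial curve. -/
abbrev CoordRing : Type _ := MvPolynomial (Option ι) K ⧸ homogenizeIdeal (toricIdeal K a)

/-- The residue class of the monomial `x_0 ^ j x ^ α`. -/
def coordMonomial (j : ℕ) (α : ι →₀ ℕ) : CoordRing K a :=
  Ideal.Quotient.mk _ (X none ^ j * rename some (monomial α 1))

/-- The map `S[x_0] / I(a)^h → K[s][t]` induced by `curveMap`. -/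
def coordMap : CoordRing K a →ₐ[K] Polynomial (Polynomial K) :=
  Ideal.Quotient.liftₐ _ (curveMap K a) fun _ hp => homogenizeIdeal_le_ker K a hp

theorem coordMap_coordMonomial (j : ℕ) (α : ι →₀ ℕ) :
    coordMap K a (coordMonomial K a j α) =
      Polynomial.monomial (Finsupp.weight a α) (Polynomial.monomial (j + α.degree) 1) :=
  curveMap_X_none_pow_mul K a j α

variable {K a} in
theorem coordMonomial_eq {j k : ℕ} {α β : ι →₀ ℕ}
    (hw : Finsupp.weight a α = Finsupp.weight a β) (hdeg : j + α.degree = k + β.degree) :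
    coordMonomial K a j α = coordMonomial K a k β :=
  Ideal.Quotient.eq.2 (X_none_pow_mul_sub_mem_homogenizeIdeal hw hdeg)

theorem coordMonomial_add (j k : ℕ) (α β : ι →₀ ℕ) :
    coordMonomial K a (j + k) (α + β) = coordMonomial K a j α * coordMonomial K a k β := by
  rw [coordMonomial, coordMonomial, coordMonomial, ← map_mul]
  congr 1
  rw [← mul_one (1 : K), ← monomial_mul, map_mul, pow_add, mul_one]
  ring

theorem coordMonomial_pow (j : ℕ) (α : ι →₀ ℕ) (k : ℕ) :
    coordMonomial K a j α ^ k = coordMonomial K a (k * j) (k • α) := by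
  induction k with
  | zero => simp [coordMonomial]
  | succ k ih => rw [pow_succ, ih, ← coordMonomial_add, add_mul, one_mul, succ_nsmul]

variable {K} in
theorem monomial_option_eq (α : Option ι →₀ ℕ) (c : K) :
    monomial α c = c • (X none ^ α none * rename some (monomial α.some 1)) := by
  classical
  have h : Finsupp.single none (α none) + Finsupp.mapDomain some α.some = α := by
    refine Finsupp.ext fun o => ?_
    cases o with
    | none => simp [Finsupp.mapDomain_of_notMem_range]
    | some i => simp [Finsupp.mapDomain_apply (Option.some_injective ι)]
  rw [rename_monomial, X_pow_eq_monomial, monomial_mul, smul_monomial, h]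
  simp

theorem mk_monomial (α : Option ι →₀ ℕ) (c : K) :
    (Ideal.Quotient.mk _ (monomial α c) : CoordRing K a) =
      c • coordMonomial K a (α none) α.some := by
  rw [monomial_option_eq]; rfl

theorem span_coordMonomial :
    Submodule.span K (Set.range fun p : ℕ × (ι →₀ ℕ) => coordMonomial K a p.1 p.2) = ⊤ := by
  rw [eq_top_iff]
  rintro x -
  obtain ⟨p, rfl⟩ := Ideal.Quotient.mk_surjective x
  rw [p.as_sum, map_sum]
  refine Submodule.sum_mem _ fun α _ => ?_
  rw [mk_monomial]
  exact Submodule.smul_mem _ _ (Submodule.subset_span ⟨(_, _), rfl⟩)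

open Classical in
/-- A linear map that inverts `coordMap` on its image: it sends `s ^ v t ^ u` to the class of some
monomial with that image, if there is one. -/
def coordSection : Polynomial (Polynomial K) →ₗ[K] CoordRing K a :=
  ((Polynomial.basisMonomials K).smulTower (Polynomial.basisMonomials (Polynomial K))).constr K
    fun p => if h : ∃ q : ℕ × (ι →₀ ℕ), Finsupp.weight a q.2 = p.2 ∧ q.1 + q.2.degree = p.1 then
      coordMonomial K a h.choose.1 h.choose.2 else 0

theorem coordSection_coordMap (x : CoordRing K a) : coordSection K a (coordMap K a x) = x := by
  have h : (coordSection K a ∘ₗ (coordMap K a).toLinearMap) = LinearMap.id := by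
    refine LinearMap.ext_on_range (span_coordMonomial K a) fun p => ?_
    have hex : ∃ q : ℕ × (ι →₀ ℕ), Finsupp.weight a q.2 = Finsupp.weight a p.2 ∧
      q.1 + q.2.degree = p.1 + p.2.degree := ⟨p, rfl, rfl⟩
    have hb : coordMap K a (coordMonomial K a p.1 p.2) =
        ((Polynomial.basisMonomials K).smulTower (Polynomial.basisMonomials (Polynomial K)))
          (p.1 + p.2.degree, Finsupp.weight a p.2) := by
      rw [coordMap_coordMonomial, Module.Basis.smulTower_apply]
      simp [Polynomial.smul_monomial]
    rw [LinearMap.comp_apply, AlgHom.toLinearMap_apply, hb, coordSection,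
      Module.Basis.constr_basis, dif_pos hex]
    exact coordMonomial_eq hex.choose_spec.1 hex.choose_spec.2
  exact LinearMap.congr_fun h x

/-- `I(a)^h` is the whole kernel of `curveMap`, as it contains all homogeneous binomials with equal
images. -/
theorem coordMap_injective : Function.Injective (coordMap K a) :=
  Function.LeftInverse.injective (coordSection_coordMap K a)

instance : IsDomain (CoordRing K a) :=
  (coordMap_injective K a).isDomain (coordMap K a).toRingHom

theorem coordMonomial_ne_zero (j : ℕ) (α : ι →₀ ℕ) : coordMonomial K a j α ≠ 0 := by
  intro h
  have := congrArg (coordMap K a) h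
  rw [coordMap_coordMonomial, map_zero, Polynomial.monomial_eq_zero_iff,
    Polynomial.monomial_eq_zero_iff] at this
  exact one_ne_zero this

end CoordRing

/-! ### A Cohen–Macaulay criterion -/

section Criterion

open RingTheory.Sequence

/-- In `K[s][t]`, a nonzero polynomial in `s` followed by a monic polynomial in `t` is a weakly
regular sequence. -/
theorem isWeaklyRegular_C_map {A : Type*} [CommRing A] [IsDomain A] {f : A}
    {g : Polynomial A} (hf : f ≠ 0) (hg : g.Monic) :
    IsWeaklyRegular (Polynomial A) [Polynomial.C f, g] := by
  rw [isWeaklyRegular_cons_iff]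
  constructor
  · intro p q hpq
    exact mul_left_cancel₀ (Polynomial.C_ne_zero.2 hf) hpq
  rw [isWeaklyRegular_cons_iff]
  refine ⟨?_, IsWeaklyRegular.nil _ _⟩
  rw [isSMulRegular_quotient_iff_mem_of_smul_mem]
  intro p hp
  rw [Submodule.mem_smul_pointwise_iff_exists] at hp ⊢
  obtain ⟨q, -, hq⟩ := hp
  simp only [smul_eq_mul] at hq ⊢
  have h0 : f • (q %ₘ g) = 0 := by
    rw [← Polynomial.smul_modByMonic, Polynomial.smul_eq_C_mul, hq,
      Polynomial.modByMonic_eq_zero_iff_dvd hg]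
    exact dvd_mul_right g p
  rw [smul_eq_zero_iff_right hf, Polynomial.modByMonic_eq_zero_iff_dvd hg] at h0
  obtain ⟨r, rfl⟩ := h0
  refine ⟨r, trivial, mul_left_cancel₀ hg.ne_zero ?_⟩
  rw [← hq]; ring

theorem ringKrullDim_le_of_isIntegral (A R : Type*) [CommRing A] [CommRing R] [Algebra A R]
    [Algebra.IsIntegral A R] : ringKrullDim R ≤ ringKrullDim A :=
  Order.krullDim_le_of_strictMono (PrimeSpectrum.comap (algebraMap A R))
    fun _ _ h => Ideal.IsIntegral.comap_lt_comap h

theorem aevalAeval_map_C {A R : Type*} [CommRing A] [CommRing R] [Algebra A R] (x y : R)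
    (p : Polynomial A) :
    Polynomial.aevalAeval x y (p.map Polynomial.C) = Polynomial.aeval y p := by
  induction p using Polynomial.induction_on' with
  | add p q hp hq => rw [Polynomial.map_add, map_add, map_add, hp, hq]
  | monomial k c => simp [← Polynomial.C_mul_X_pow_eq_monomial]

variable {K R B : Type*} [Field K] [CommRing R] [Algebra K R] [Algebra.FiniteType K R]

/-- A finitely generated `K`-algebra that is integral over two of its elements `x`, `y`, and has a
`K`-basis of the form `b x ^ j y ^ k`, is Cohen–Macaulay: it is free over `K[s][t]`, and at each
maximal ideal the minimal polynomials of the residue classes of `x` and `y` give a regular sequence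
of length `2`. -/
theorem isCohenMacaulay_of_basis (x y : R)
    (hint : (Polynomial.aevalAeval (R := K) x y).toRingHom.IsIntegral)
    (b : B → R) (bas : Module.Basis (B × ℕ × ℕ) K R)
    (hbas : ∀ β j k, bas (β, j, k) = b β * x ^ j * y ^ k) : IsCohenMacaulay R := by
  have hnoeth : IsNoetherianRing R := Algebra.FiniteType.isNoetherianRing K R
  refine ⟨hnoeth, fun P hP => ?_⟩
  let : Algebra (Polynomial (Polynomial K)) R :=
    (Polynomial.aevalAeval (R := K) x y).toRingHom.toAlgebra
  have halg : ∀ p : Polynomial (Polynomial K),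
    algebraMap (Polynomial (Polynomial K)) R p = Polynomial.aevalAeval x y p := fun _ => rfl
  have : IsScalarTower K (Polynomial (Polynomial K)) R :=
    IsScalarTower.of_algebraMap_eq' (Polynomial.aevalAeval (R := K) x y).comp_algebraMap.symm
  have : Algebra.IsIntegral (Polynomial (Polynomial K)) R := ⟨hint⟩
  -- `R` is free with basis `b`, because `b` takes a `K`-basis to a `K`-basis.
  let L : (B →₀ Polynomial (Polynomial K)) →ₗ[Polynomial (Polynomial K)] R :=
    Finsupp.linearCombination _ b
  let bA := (Polynomial.basisMonomials K).smulTower (Polynomial.basisMonomials (Polynomial K))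
  let bF : Module.Basis (Σ _ : B, ℕ × ℕ) K (B →₀ Polynomial (Polynomial K)) :=
    Finsupp.basis fun _ => bA
  let E := bF.equiv bas (Equiv.sigmaEquivProd B (ℕ × ℕ))
  have hLE : L.restrictScalars K = E.toLinearMap := by
    refine bF.ext fun i => ?_
    obtain ⟨β, j, k⟩ := i
    have h1 : bF ⟨β, j, k⟩ = Finsupp.single β (bA (j, k)) := by
      simp [bF, Finsupp.coe_basis]
    rw [LinearEquiv.coe_coe, Module.Basis.equiv_apply, Equiv.sigmaEquivProd_apply, hbas, h1,
      LinearMap.restrictScalars_apply, Finsupp.linearCombination_single, Algebra.smul_def, halg,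
      Module.Basis.smulTower_apply]
    simp [Polynomial.smul_monomial]
    ring
  have hL : Function.Bijective L := by
    have : ⇑L = ⇑E := congrArg (fun l : _ →ₗ[K] R => ⇑l) hLE
    rw [this]; exact E.bijective
  have : Module.Free (Polynomial (Polynomial K)) R :=
    Module.Free.of_equiv (LinearEquiv.ofBijective L hL)
  -- The residue field is finite over `K`.
  let := Ideal.Quotient.field P
  have : Module.Finite K (R ⧸ P) := finite_of_finite_type_of_isJacobsonRing K (R ⧸ P)
  have hmem : ∀ z : R, Polynomial.aeval z (minpoly K (Ideal.Quotient.mk P z)) ∈ P := by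
    intro z
    rw [← Ideal.Quotient.eq_zero_iff_mem]
    have := minpoly.aeval K (Ideal.Quotient.mk P z)
    rwa [← Ideal.Quotient.mkₐ_eq_mk K, Polynomial.aeval_algHom_apply] at this
  set f := minpoly K (Ideal.Quotient.mk P x) with hf
  set g := (minpoly K (Ideal.Quotient.mk P y)).map (Polynomial.C : K →+* Polynomial K) with hg
  have hreg : IsWeaklyRegular (Polynomial (Polynomial K)) [Polynomial.C f, g] :=
    isWeaklyRegular_C_map (minpoly.ne_zero (Algebra.IsIntegral.isIntegral _))
      ((minpoly.monic (Algebra.IsIntegral.isIntegral _)).map _)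
  have hfg : ∀ r ∈ [Polynomial.C f, g].map (algebraMap (Polynomial (Polynomial K)) R), r ∈ P := by
    simp only [List.map_cons, List.map_nil, List.mem_cons, List.not_mem_nil, or_false]
    rintro r (rfl | rfl)
    · rw [halg]
      simpa using hmem x
    · rw [halg, hg, aevalAeval_map_C]
      exact hmem y
  have hregP := (hreg.of_flat (S := R)).isRegular_of_isLocalization_of_mem
    (Localization.AtPrime P) P hfg
  have hnoethP : IsNoetherianRing (Localization.AtPrime P) :=
    IsLocalization.isNoetherianRing P.primeCompl _ hnoeth
  refine ⟨hnoethP, _, ?_, hregP, le_antisymm ?_ ?_⟩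
  · intro r hr
    obtain ⟨z, hz, rfl⟩ := List.mem_map.1 hr
    exact (IsLocalization.AtPrime.to_map_mem_maximal_iff _ P z).2 (hfg z hz)
  · rw [← ringKrullDim_add_length_eq_ringKrullDim_of_isRegular _ hregP]
    have : Nontrivial (Localization.AtPrime P ⧸ Ideal.ofList
        (([Polynomial.C f, g].map (algebraMap (Polynomial (Polynomial K)) R)).map
          (algebraMap R (Localization.AtPrime P)))) := by
      rw [Ideal.Quotient.nontrivial_iff]
      intro h
      exact hregP.2 (by rw [h, smul_eq_mul, Ideal.top_mul])
    exact le_add_of_nonneg_left ringKrullDim_nonneg_of_nontrivial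
  · rw [IsLocalization.AtPrime.ringKrullDim_eq_height P]
    refine (Ideal.height_le_ringKrullDim_of_ne_top hP.ne_top).trans
      ((ringKrullDim_le_of_isIntegral (Polynomial (Polynomial K)) R).trans ?_)
    rw [Polynomial.ringKrullDim_of_isNoetherianRing, Polynomial.ringKrullDim_of_isNoetherianRing,
      ringKrullDim_eq_zero_of_field]
    norm_num

/-- If `m` is the annihilator of an element of `R / x R`, where `R` is a domain, then the local ring
`R_m` has no regular sequence of length `2` in its maximal ideal. The last hypothesis says that `m` is the only prime ideal containing
the annihilator of the class of `r`, so that `m` is an associated prime of `R / x R`. -/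
theorem not_isCohenMacaulayLocal_of_colon {R : Type*} [CommRing R] [IsDomain R]
    [IsNoetherianRing R] (m : Ideal R) [m.IsPrime] (hm : 2 ≤ m.height) {x r : R} (hx : x ≠ 0)
    (hr : ¬ x ∣ r) (hcolon : ∀ p : Ideal R, p.IsPrime → (∀ c, x ∣ c * r → c ∈ p) → p = m) :
    ¬ IsCohenMacaulayLocal (Localization.AtPrime m) := by
  rintro ⟨-, rs, hmem, hreg, hlen⟩
  have hr0 : (Ideal.Quotient.mk (Ideal.span {x}) r) ≠ 0 := by
    rwa [Ne, Ideal.Quotient.eq_zero_iff_mem, Ideal.mem_span_singleton]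
  obtain ⟨p, hp, hle⟩ := exists_le_isAssociatedPrime_of_isNoetherianRing R _ hr0
  obtain ⟨hprime, z, hz⟩ := isAssociatedPrime_iff.1 hp
  obtain ⟨s, rfl⟩ := Ideal.Quotient.mk_surjective z
  have hann : ∀ (t c : R), c ∈ (⊥ : Submodule R (R ⧸ Ideal.span {x})).colon
      {Ideal.Quotient.mk (Ideal.span {x}) t} ↔ x ∣ c * t := by
    intro t c
    rw [Submodule.mem_colon_singleton, Submodule.mem_bot, ← Ideal.mem_span_singleton,
      ← Ideal.Quotient.eq_zero_iff_mem, Algebra.smul_def, map_mul]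
    rfl
  have hpm : p = m := hcolon p hprime fun c hc => hle ((hann r c).2 hc)
  have hs : ∀ c, c ∈ m ↔ x ∣ c * s := fun c => by rw [← hpm, hz, hann]
  set φ := algebraMap R (Localization.AtPrime m) with hφ
  have hinj : Function.Injective φ :=
    IsLocalization.injective _ m.primeCompl_le_nonZeroDivisors
  have hmax : ∀ y ∈ IsLocalRing.maximalIdeal (Localization.AtPrime m), φ x ∣ y * φ s := by
    intro y hy
    obtain ⟨c, v, rfl⟩ := IsLocalization.exists_mk'_eq m.primeCompl y
    rw [IsLocalization.AtPrime.mk'_mem_maximal_iff (Localization.AtPrime m) m] at hy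
    obtain ⟨d, hd⟩ := (hs c).1 hy
    refine ⟨IsLocalization.mk' _ d v, ?_⟩
    rw [mul_comm, IsLocalization.mul_mk'_eq_mk'_of_mul, IsLocalization.mul_mk'_eq_mk'_of_mul,
      mul_comm s, hd]
  have hnot : ¬ φ x ∣ φ s := by
    rintro ⟨y, hy⟩
    obtain ⟨c, v, rfl⟩ := IsLocalization.exists_mk'_eq m.primeCompl y
    refine v.2 ((hs v).2 ⟨c, hinj ?_⟩)
    rw [map_mul, hy, map_mul, ← IsLocalization.mk'_spec (Localization.AtPrime m) c v]
    ring
  have hlen2 : 2 ≤ rs.length := by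
    rw [IsLocalization.AtPrime.ringKrullDim_eq_height m] at hlen
    have h : ((2 : ℕ∞) : WithBot ℕ∞) ≤ (m.height : WithBot ℕ∞) := WithBot.coe_le_coe.2 hm
    rw [← hlen] at h
    exact_mod_cast h
  obtain ⟨y₁, y₂, t, rfl⟩ : ∃ y₁ y₂ t, rs = y₁ :: y₂ :: t := by
    match rs, hlen2 with
    | y₁ :: y₂ :: t, _ => exact ⟨y₁, y₂, t, rfl⟩
  obtain ⟨h₁, h₂⟩ := (isWeaklyRegular_cons_iff _ _ _).1 hreg.toIsWeaklyRegular
  obtain ⟨h₂, -⟩ := (isWeaklyRegular_cons_iff _ _ _).1 h₂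
  rw [isSMulRegular_quotient_iff_mem_of_smul_mem] at h₂
  obtain ⟨p₁, hp₁⟩ := hmax y₁ (hmem _ (by simp))
  obtain ⟨p₂, hp₂⟩ := hmax y₂ (hmem _ (by simp))
  have hφx : φ x ≠ 0 := by rwa [Ne, map_eq_zero_iff φ hinj]
  have hcross : y₂ * p₁ = y₁ * p₂ := by
    refine mul_left_cancel₀ hφx ?_
    linear_combination (-y₂) * hp₁ + y₁ * hp₂
  have hp₁mem := h₂ p₁ (by
    rw [Submodule.mem_smul_pointwise_iff_exists]
    exact ⟨p₂, trivial, hcross.symm⟩)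
  rw [Submodule.mem_smul_pointwise_iff_exists] at hp₁mem
  obtain ⟨q, -, rfl⟩ := hp₁mem
  refine hnot ⟨q, h₁ ?_⟩
  change y₁ * φ s = y₁ * (φ x * q)
  rw [hp₁, smul_eq_mul]; ring

end Criterion

/-! ### Arithmetically Cohen–Macaulay monomial curves -/

section ACM

variable {n : ℕ} (K : Type*) [Field K] {a : Fin (n + 1) → ℕ}

theorem mk_X_none : (Ideal.Quotient.mk _ (X none) : CoordRing K a) = coordMonomial K a 1 0 := by
  simp [coordMonomial]

theorem mk_X_some (i : Fin (n + 1)) : (Ideal.Quotient.mk _ (X (some i)) : CoordRing K a) =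
    coordMonomial K a 0 (Finsupp.single i 1) := by
  rw [coordMonomial, pow_zero, one_mul]
  congr 1
  exact (rename_X some i).symm

theorem coordMonomial_single_pow (hle : ∀ i, a i ≤ a (Fin.last n)) (i : Fin (n + 1)) :
    coordMonomial K a 0 (Finsupp.single i 1) ^ a (Fin.last n) =
      coordMonomial K a 1 0 ^ (a (Fin.last n) - a i) *
        coordMonomial K a 0 (Finsupp.single (Fin.last n) 1) ^ a i := by
  rw [coordMonomial_pow, coordMonomial_pow, coordMonomial_pow, ← coordMonomial_add]
  have := hle i
  refine coordMonomial_eq ?_ ?_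
  · simp [Finsupp.weight_single, mul_comm]
  · simp; omega

/-- The coordinate ring is integral over the subalgebra generated by `x_0` and `x_n`, because
`x_i ^ a_n = x_0 ^ (a_n - a_i) x_n ^ a_i`. -/
theorem isIntegral_aevalAeval (hpos : 0 < a (Fin.last n)) (hle : ∀ i, a i ≤ a (Fin.last n)) :
    (Polynomial.aevalAeval (R := K) (coordMonomial K a 1 0)
      (coordMonomial K a 0 (Finsupp.single (Fin.last n) 1))).toRingHom.IsIntegral := by
  intro z
  obtain ⟨p, rfl⟩ := Ideal.Quotient.mk_surjective z
  set ψ := (Polynomial.aevalAeval (R := K) (coordMonomial K a 1 0)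
      (coordMonomial K a 0 (Finsupp.single (Fin.last n) 1))) with hψ
  have hx : ψ (Polynomial.C Polynomial.X) = coordMonomial K a 1 0 :=
    Polynomial.aevalAeval_X _ _
  have hy : ψ Polynomial.X = coordMonomial K a 0 (Finsupp.single (Fin.last n) 1) :=
    Polynomial.aevalAeval_Y _ _
  induction p using MvPolynomial.induction_on with
  | C c =>
    have : (Ideal.Quotient.mk _ (C c) : CoordRing K a) =
        ψ (algebraMap K (Polynomial (Polynomial K)) c) := by
      rw [AlgHom.commutes]; rfl
    rw [this]
    exact ψ.toRingHom.isIntegralElem_map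
  | add p q hp hq => rw [map_add]; exact hp.add _ hq
  | mul_X p o hp =>
    rw [map_mul]
    refine hp.mul _ ?_
    cases o with
    | none =>
      rw [mk_X_none, ← hx]
      exact ψ.toRingHom.isIntegralElem_map
    | some i =>
      rw [mk_X_some]
      let := ψ.toRingHom.toAlgebra
      refine IsIntegral.of_pow (R := Polynomial (Polynomial K)) hpos ?_
      rw [coordMonomial_single_pow K hle, ← hx, ← hy, ← map_pow ψ, ← map_pow ψ, ← map_mul ψ]
      exact ψ.toRingHom.isIntegralElem_map

/-- If `x_n` preserves standard monomials, the classes of the monomials `x_0 ^ j x ^ β x_n ^ k`,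
with `x ^ β` standard and prime to `x_n`, are a basis of the coordinate ring. -/
theorem isACM_of_lastFree {e : Fin (n + 1) ≃ Fin (n + 1)} (hpos : 0 < a (Fin.last n))
    (hle : ∀ i, a i ≤ a (Fin.last n)) (h : LastFree e a) : IsACM K a := by
  let B := {β : Fin (n + 1) →₀ ℕ // IsStandard (revLex e) a β ∧ β (Fin.last n) = 0}
  let v : B × ℕ × ℕ → CoordRing K a := fun p =>
    coordMonomial K a p.2.1 (p.1.1 + Finsupp.single (Fin.last n) p.2.2)
  let bA := (Polynomial.basisMonomials K).smulTower (Polynomial.basisMonomials (Polynomial K))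
  let key : B × ℕ × ℕ → ℕ × ℕ := fun p =>
    (p.2.1 + (p.1.1 + Finsupp.single (Fin.last n) p.2.2).degree,
      Finsupp.weight a (p.1.1 + Finsupp.single (Fin.last n) p.2.2))
  have hkey : Function.Injective key := by
    rintro ⟨⟨β, hβ, hβ0⟩, j, k⟩ ⟨⟨β', hβ', hβ0'⟩, j', k'⟩ heq
    obtain ⟨h1, h2⟩ := Prod.mk.inj heq
    have h3 := (h.add_single hβ k).eq (h.add_single hβ' k') h2
    rw [h3] at h1
    have hk : k = k' := by
      have := DFunLike.congr_fun h3 (Fin.last n)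
      simpa [hβ0, hβ0'] using this
    subst hk
    have hb : β = β' := add_right_cancel h3
    subst hb
    have hj : j = j' := by simpa using h1
    rw [hj]
  have hli : LinearIndependent K v := by
    refine LinearIndependent.of_comp (coordMap K a).toLinearMap ?_
    have : (coordMap K a).toLinearMap ∘ v = bA ∘ key := by
      funext p
      rw [Function.comp_apply, Function.comp_apply, AlgHom.toLinearMap_apply,
        coordMap_coordMonomial, Module.Basis.smulTower_apply]
      simp [Polynomial.smul_monomial, key]
    rw [this]
    exact bA.linearIndependent.comp key hkey
  have hspan : ⊤ ≤ Submodule.span K (Set.range v) := by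
    rw [← span_coordMonomial K a, Submodule.span_le]
    rintro _ ⟨⟨j, γ⟩, rfl⟩
    obtain ⟨δ, hδ, hstd⟩ := exists_isStandard (revLex e) a γ
    have hdeg := degree_le_of_toSyn_le (hstd γ hδ.symm)
    refine Submodule.subset_span ⟨⟨⟨δ.erase (Fin.last n), h.isStandard_erase_iff.2 hstd, by simp⟩,
      j + (γ.degree - δ.degree), δ (Fin.last n)⟩, ?_⟩
    refine coordMonomial_eq ?_ ?_
    · rw [Finsupp.erase_add_single, hδ]
    · rw [Finsupp.erase_add_single]
      change j + (γ.degree - δ.degree) + δ.degree = j + γ.degree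
      omega
  refine isCohenMacaulay_of_basis (coordMonomial K a 1 0)
    (coordMonomial K a 0 (Finsupp.single (Fin.last n) 1)) (isIntegral_aevalAeval K hpos hle)
    (fun β : B => coordMonomial K a 0 β.1) (Module.Basis.mk hli hspan) fun β j k => ?_
  rw [Module.Basis.mk_apply, coordMonomial_pow, coordMonomial_pow, ← coordMonomial_add,
    ← coordMonomial_add]
  simp [v]

variable (a)

/-- Evaluation of the coordinate ring at the face `t = 0` of `K[s][t]`. -/
def faceMap : CoordRing K a →ₐ[K] Polynomial K :=
  ((Polynomial.aeval (0 : Polynomial K)).restrictScalars K).comp (coordMap K a)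

/-- Evaluation of the coordinate ring at the vertex `s = t = 0` of the affine cone. -/
def vertexMap : CoordRing K a →ₐ[K] K := (Polynomial.aeval (0 : K)).comp (faceMap K a)

/-- The irrelevant maximal ideal of the coordinate ring. -/
def irrelevantIdeal : Ideal (CoordRing K a) := RingHom.ker (vertexMap K a)

instance : (irrelevantIdeal K a).IsMaximal :=
  RingHom.ker_isMaximal_of_surjective (vertexMap K a)
    fun c => ⟨algebraMap K _ c, (vertexMap K a).commutes c⟩

theorem faceMap_coordMonomial (j : ℕ) (α : Fin (n + 1) →₀ ℕ) :
    faceMap K a (coordMonomial K a j α) =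
      if Finsupp.weight a α = 0 then Polynomial.X ^ (j + α.degree) else 0 := by
  change Polynomial.aeval (0 : Polynomial K) (coordMap K a (coordMonomial K a j α)) = _
  rw [coordMap_coordMonomial, Polynomial.aeval_monomial]
  split_ifs with h
  · rw [h, pow_zero, mul_one, ← Polynomial.X_pow_eq_monomial]; rfl
  · rw [zero_pow h, mul_zero]

theorem coordMonomial_mem_irrelevantIdeal {j : ℕ} {α : Fin (n + 1) →₀ ℕ}
    (h : j + α.degree ≠ 0) : coordMonomial K a j α ∈ irrelevantIdeal K a := by
  change Polynomial.aeval (0 : K) (faceMap K a (coordMonomial K a j α)) = 0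
  rw [faceMap_coordMonomial]
  split_ifs
  · rw [map_pow, Polynomial.aeval_X, zero_pow h]
  · rw [map_zero]

variable {a}

/-- The ideal of the face `t = 0` lies strictly between `0` and the irrelevant ideal. -/
theorem two_le_height_irrelevantIdeal (hpos : 0 < a (Fin.last n)) :
    2 ≤ (irrelevantIdeal K a).height := by
  have hq : (RingHom.ker (faceMap K a)).IsPrime := RingHom.ker_isPrime _
  have hbot : (⊥ : Ideal (CoordRing K a)).IsPrime := Ideal.isPrime_bot
  have h1 : (⊥ : Ideal (CoordRing K a)) < RingHom.ker (faceMap K a) := by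
    rw [bot_lt_iff_ne_bot, Ne, Submodule.eq_bot_iff]
    intro h
    refine coordMonomial_ne_zero K a 0 (Finsupp.single (Fin.last n) 1) (h _ ?_)
    rw [RingHom.mem_ker, faceMap_coordMonomial, if_neg]
    simpa [Finsupp.weight_single] using hpos.ne'
  have h2 : RingHom.ker (faceMap K a) < irrelevantIdeal K a := by
    refine lt_of_le_of_ne ?_ fun heq => ?_
    · intro z hz
      change Polynomial.aeval (0 : K) (faceMap K a z) = 0
      rw [RingHom.mem_ker.1 hz, map_zero]
    · have hx : coordMonomial K a 1 0 ∈ RingHom.ker (faceMap K a) :=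
        heq ▸ coordMonomial_mem_irrelevantIdeal K a (by simp)
      rw [RingHom.mem_ker, faceMap_coordMonomial, if_pos (by simp)] at hx
      exact pow_ne_zero _ Polynomial.X_ne_zero hx
  have h3 := Ideal.height_add_one_le_of_lt_of_isPrime h1
  have h4 := Ideal.height_add_one_le_of_lt_of_isPrime h2
  calc (2 : ℕ∞) = 0 + 1 + 1 := by norm_num
    _ ≤ (⊥ : Ideal (CoordRing K a)).height + 1 + 1 := by gcongr; exact zero_le
    _ ≤ _ := (add_le_add_left h3 1).trans h4

/-- A prime ideal containing `x_0` and `x_n` is the irrelevant ideal. -/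
theorem eq_irrelevantIdeal (hpos : 0 < a (Fin.last n)) (hle : ∀ i, a i ≤ a (Fin.last n))
    {p : Ideal (CoordRing K a)} (hp : p.IsPrime) (hx : coordMonomial K a 1 0 ∈ p)
    (hy : coordMonomial K a 0 (Finsupp.single (Fin.last n) 1) ∈ p) :
    p = irrelevantIdeal K a := by
  have hgen : ∀ o : Option (Fin (n + 1)),
      (Ideal.Quotient.mk _ (X o) : CoordRing K a) ∈ p ⊓ irrelevantIdeal K a := by
    intro o
    cases o with
    | none =>
      rw [mk_X_none]
      exact ⟨hx, coordMonomial_mem_irrelevantIdeal K a (by simp)⟩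
    | some i =>
      rw [mk_X_some]
      refine ⟨hp.mem_of_pow_mem (a (Fin.last n)) ?_,
        coordMonomial_mem_irrelevantIdeal K a (by simp)⟩
      rw [coordMonomial_single_pow K hle]
      by_cases hi : a i = 0
      · exact Ideal.mul_mem_right _ _ (Ideal.pow_mem_of_mem _ hx _ (by omega))
      · exact Ideal.mul_mem_left _ _ (Ideal.pow_mem_of_mem _ hy _ (by omega))
  have hconst : ∀ f : MvPolynomial (Option (Fin (n + 1))) K, ∃ c : K,
      (Ideal.Quotient.mk _ f : CoordRing K a) - algebraMap K _ c ∈ p ⊓ irrelevantIdeal K a := by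
    intro f
    induction f using MvPolynomial.induction_on with
    | C c => exact ⟨c, by
      have hc : (Ideal.Quotient.mk _ (C c) : CoordRing K a) = algebraMap K _ c := rfl
      rw [hc, sub_self]
      exact zero_mem _⟩
    | add f g hf hg =>
      obtain ⟨c, hc⟩ := hf
      obtain ⟨d, hd⟩ := hg
      refine ⟨c + d, ?_⟩
      rw [map_add, map_add, add_sub_add_comm]
      exact add_mem hc hd
    | mul_X f o _ =>
      refine ⟨0, ?_⟩
      rw [map_zero, sub_zero, map_mul]
      exact Ideal.mul_mem_left _ _ (hgen o)
  have hmax : (irrelevantIdeal K a).IsMaximal := inferInstance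
  refine (hmax.eq_of_le hp.ne_top fun z hz => ?_).symm
  obtain ⟨f, rfl⟩ := Ideal.Quotient.mk_surjective z
  obtain ⟨c, hc⟩ := hconst f
  have hc0 : algebraMap K (CoordRing K a) c ∈ irrelevantIdeal K a := by
    have := sub_mem hz hc.2
    rwa [sub_sub_cancel] at this
  have hc1 : c = 0 := by
    have : vertexMap K a (algebraMap K _ c) = 0 := hc0
    rwa [AlgHom.commutes] at this
  have := hc.1
  rwa [hc1, map_zero, sub_zero] at this

theorem not_coordMonomial_dvd {e : Fin (n + 1) ≃ Fin (n + 1)} {α : Fin (n + 1) →₀ ℕ}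
    (hα : IsStandard (revLex e) a α) : ¬ coordMonomial K a 1 0 ∣ coordMonomial K a 0 α := by
  rintro ⟨c, hc⟩
  have h1 := congrArg (fun z => ((coordMap K a z).coeff (Finsupp.weight a α)).coeff α.degree) hc
  simp only [map_mul, coordMap_coordMonomial, map_zero, zero_add, add_zero,
    Polynomial.coeff_monomial, if_true, Polynomial.monomial_zero_left, Polynomial.coeff_C_mul] at h1
  rw [Polynomial.monomial_one_one_eq_X] at h1
  rcases Nat.eq_zero_or_pos α.degree with h0 | h0
  · rw [h0, Polynomial.coeff_X_mul_zero] at h1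
    exact one_ne_zero h1
  obtain ⟨d, hd⟩ := Nat.exists_eq_succ_of_ne_zero h0.ne'
  rw [hd, Nat.succ_eq_add_one, Polynomial.coeff_X_mul] at h1
  -- No monomial of degree less than `deg x ^ α` has the same weight, so this coefficient vanishes.
  let ℓ : CoordRing K a →ₗ[K] K := Polynomial.lcoeff K d ∘ₗ
    (Polynomial.lcoeff (Polynomial K) (Finsupp.weight a α)).restrictScalars K ∘ₗ
    (coordMap K a).toLinearMap
  have hℓ : ℓ = 0 := by
    refine LinearMap.ext_on_range (span_coordMonomial K a) fun p => ?_
    change ((coordMap K a (coordMonomial K a p.1 p.2)).coeff (Finsupp.weight a α)).coeff d = 0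
    rw [coordMap_coordMonomial, Polynomial.coeff_monomial]
    split_ifs with hw
    · rw [Polynomial.coeff_monomial, if_neg]
      have := degree_le_of_toSyn_le (hα _ hw)
      omega
    · rw [Polynomial.coeff_zero]
  exact one_ne_zero (h1.trans (LinearMap.congr_fun hℓ c))

theorem lastFree_of_isACM {e : Fin (n + 1) ≃ Fin (n + 1)} (he : e (Fin.last n) = Fin.last n)
    (hpos : 0 < a (Fin.last n)) (hle : ∀ i, a i ≤ a (Fin.last n)) (h : IsACM K a) :
    LastFree e a := by
  rw [lastFree_iff]
  intro γ hγ
  by_contra hne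
  obtain ⟨β, hβ, hstd⟩ := exists_isStandard (revLex e) a γ
  have hβ0 : β (Fin.last n) = 0 :=
    (eq_zero_or_eq_zero_of_minimal hγ hstd hβ (Fin.last n)).resolve_left hne
  have hdeg : β.degree < γ.degree := by
    by_contra! hd
    exact absurd (hstd γ hβ.symm) (not_le.2 (toSyn_lt_of_last_lt he hd (by omega)))
  have hle1 : Finsupp.single (Fin.last n) 1 ≤ γ := by
    rw [Finsupp.single_le_iff]; omega
  obtain ⟨α, rfl⟩ := exists_add_of_le hle1
  have hα : IsStandard (revLex e) a α := by
    by_contra hn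
    have := hγ.2 hn (by simp) (Fin.last n)
    simp at this
  have hnoeth : IsNoetherianRing (CoordRing K a) := h.1
  refine not_isCohenMacaulayLocal_of_colon (irrelevantIdeal K a)
    (two_le_height_irrelevantIdeal K hpos) (coordMonomial_ne_zero K a 1 0)
    (not_coordMonomial_dvd K hα) (fun p hp hc => ?_) (h.2 (irrelevantIdeal K a))
  refine eq_irrelevantIdeal K hpos hle hp (hc _ (dvd_mul_right _ _)) (hc _ ?_)
  -- `x_n x ^ α = x_0 (x_0 ^ j x ^ β)`, where `j` makes the degrees equal.
  obtain ⟨j, hj⟩ := Nat.exists_eq_add_of_lt hdeg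
  refine ⟨coordMonomial K a j β, ?_⟩
  rw [← coordMonomial_add, ← coordMonomial_add]
  refine coordMonomial_eq ?_ ?_
  · rw [zero_add, hβ]
  · rw [zero_add, zero_add β, hj]; ring

theorem isACM_iff_lastFree {e : Fin (n + 1) ≃ Fin (n + 1)} (he : e (Fin.last n) = Fin.last n)
    (hpos : 0 < a (Fin.last n)) (hle : ∀ i, a i ≤ a (Fin.last n)) :
    IsACM K a ↔ LastFree e a :=
  ⟨lastFree_of_isACM K he hpos hle, isACM_of_lastFree K hpos hle⟩

end ACM

end

end MonomialCurve

/-- The variables are `x_1, …, x_N` with `N = n + 1`, indexed by `Fin (n + 1)`, and the sequence is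
`a`. The permutation `e` lists the variables in decreasing order, and `he` says that the last
variable is the smallest one. In the third condition, membership of a binomial `f_w` in a basis
comes with its orientation `in(f_w) = x^{w⁺}`, so that `f_w` determines `w` in characteristic `2`
too; the last clause is the same condition without orientation. -/
theorem theorem2p2 {K : Type*} [Field K] {n : ℕ} (a : Fin (n + 1) → ℕ)
    (hpos : 0 < a (Fin.last n)) (hlt : ∀ i, i ≠ Fin.last n → a i < a (Fin.last n))
    (e : Fin (n + 1) ≃ Fin (n + 1)) (he : e (Fin.last n) = Fin.last n)
    (G G' : Set (MvPolynomial (Fin (n + 1)) K))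
    (hG : MonomialCurve.IsReducedGroebnerBasis (MonomialCurve.revLex e)
      (MonomialCurve.toricIdeal K a) G)
    (hG' : MonomialCurve.IsReducedGroebnerBasis (MonomialCurve.revLex e)
      (MonomialCurve.toricIdeal K (MonomialCurve.dualSeq a)) G') :
    List.TFAE [
      MonomialCurve.IsACM K a,
      ∀ w : Fin (n + 1) → ℤ, MonomialCurve.binomial K w ∈ G →
        MonomialCurve.initialMonomial (MonomialCurve.revLex e)
            (MonomialCurve.binomial K (MonomialCurve.sigma w)) =
          MonomialCurve.initialMonomial (MonomialCurve.revLex e) (MonomialCurve.binomial K w),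
      ∀ w : Fin (n + 1) → ℤ,
        (MonomialCurve.binomial K w ∈ G ∧
          MonomialCurve.initialMonomial (MonomialCurve.revLex e) (MonomialCurve.binomial K w) =
            MvPolynomial.monomial (MonomialCurve.posPart w) 1) ↔
        (MonomialCurve.binomial K (MonomialCurve.sigma w) ∈ G' ∧
          MonomialCurve.initialMonomial (MonomialCurve.revLex e)
              (MonomialCurve.binomial K (MonomialCurve.sigma w)) =
            MvPolynomial.monomial (MonomialCurve.posPart (MonomialCurve.sigma w)) 1)] ∧
    ((2 : K) ≠ 0 →
      (MonomialCurve.IsACM K a ↔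
        ∀ w : Fin (n + 1) → ℤ, MonomialCurve.binomial K w ∈ G ↔
          MonomialCurve.binomial K (MonomialCurve.sigma w) ∈ G')) := by
  have hle : ∀ i, a i ≤ a (Fin.last n) := fun i => by
    rcases eq_or_ne i (Fin.last n) with rfl | h
    exacts [le_rfl, (hlt i h).le]
  have hab := MonomialCurve.isACM_iff_lastFree K he hpos hle
  have hc := MonomialCurve.lastFree_iff_isReducedBinomial_sigma he hle
  refine ⟨?_, fun h2 => ?_⟩
  · tfae_have 1 ↔ 2 := hab.trans
      (MonomialCurve.lastFree_iff_initialMonomial_sigma he hle hpos hG)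
    tfae_have 1 ↔ 3 := by
      simp only [hG.binomial_mem_iff, hG'.binomial_mem_iff]
      exact hab.trans hc
    tfae_finish
  · have hmem : ∀ {b : Fin (n + 1) → ℕ} {H : Set (MvPolynomial (Fin (n + 1)) K)}
        (_ : MonomialCurve.IsReducedGroebnerBasis (MonomialCurve.revLex e)
          (MonomialCurve.toricIdeal K b) H) (w : Fin (n + 1) → ℤ),
        MonomialCurve.binomial K w ∈ H ↔
          MonomialCurve.IsReducedBinomial (MonomialCurve.revLex e) b w := fun hH w =>
      ⟨fun hw => (hH.isReducedBinomial_or hw).resolve_right fun h => h2 h.1,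
        fun hw => (hH.binomial_mem_iff.2 hw).1⟩
    simp only [hmem hG, hmem hG']
    exact hab.trans hc
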